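/- Let $d\ge 2$, $\mathbb T^d=\mathbb R^d/(2\pi\mathbb Z)^d$ and, for $\lambda\ge 0$, let $\mathcal E_d(\lambda)=\{u\in C^\infty(\mathbb T^d;\mathbb C) : -\Delta u=\lambda^2u\}$ and $\mathcal N_d(\lambda)=\#\{k\in\mathbb Z^d : |k|=\lambda\}$. For $u\in C^\infty(\mathbb T^d;\mathbb C)$ let $\Gamma(u)$ be the largest $N\in\mathbb N=\{0,1,2,\dots\}$ such that $\partial^\alpha u(0)=0$ for all $\alpha\in\mathbb N^d$ with $|\alpha|\le N$ (with $\Gamma(u)=-\infty$ if $u(0)\ne 0$, and $\Gamma(u)=+\infty$ if all derivatives vanish at $0$), and let $\Gamma_d(\lambda)=\sup\{\Gamma(u) : 0\ne u\in\mathcal E_d(\lambda)\}$. **Theorem.** 1. For all $d\ge2$, $\lambda\ge0$ and $N\in\mathbb N$: if $$\binom{N+d-1}{d-1}+\binom{N+d-2}{d-1}<\mathcal N_d(\lambda),$$ then $\Gamma_d(\lambda)\ge N$. 2. There is an absolute constant $c>0$ such that for every $d\ge2$ there is $\lambda_0(d)>0$ with $$\Gamma_d(\lambda)\ \ge\ c\,(d-1)\,\mathcal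 N_d(\lambda)^{\frac1{d-1}}$$ for all $\lambda\ge\lambda_0(d)$ such that $\mathcal E_d(\lambda)\ne\{0\}$. Moreover, for every $d\ge2$ there is $c_d>0$ such that this inequality, with $c_d$ in place of $c$, holds for all $\lambda>0$ such that $\mathcal E_d(\lambda)\ne\{0\}$. 3. There is an absolute constant $c>0$ such that for every $d\ge5$ there is $\lambda_0(d)>0$ with $$\Gamma_d(\lambda)\ \ge\ c\,\lambda^{\frac{d-2}{d-1}}$$ for all $\lambda\ge\lambda_0(d)$ with $\lambda^2\in\mathbb N$. Moreover, for every $d\ge5$ there is $c_d>0$ such that $\Gamma_d(\lambda)\ge c_d\,(d-1)\,\lambda^{\frac{d-2}{d-1}}$ for all $\lambda>0$ with $\lambda^2\in\mathbb N$. -/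

import Mathlib

namespace TorusEigen

noncomputable section

/-- `C^∞(𝕋^d)` for the flat torus `𝕋^d = ℝ^d / (2πℤ)^d`: the smooth complex-valued functions on
`ℝ^d` that are `2π`-periodic in each coordinate. -/
def SmoothTorus (d : ℕ) : Set (EuclideanSpace ℝ (Fin d) → ℂ) :=
  {u | ContDiff ℝ (⊤ : ℕ∞) u ∧
    ∀ (j : Fin d) (x : EuclideanSpace ℝ (Fin d)),
      u (x + EuclideanSpace.single j (2 * Real.pi)) = u x}

/-- The eigenspace `𝓔_d(lam) = {u ∈ C^∞(𝕋^d) : -Δu = lam² u}`. -/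
def eigenspace (d : ℕ) (lam : ℝ) : Set (EuclideanSpace ℝ (Fin d) → ℂ) :=
  {u | u ∈ SmoothTorus d ∧ ∀ x, -(Laplacian.laplacian u x) = ((lam ^ 2 : ℝ) : ℂ) * u x}

/-- The integer points `{k ∈ ℤ^d : |k| = lam}` on the Euclidean sphere of radius `lam ≥ 0`. -/
def latticeSphere (d : ℕ) (lam : ℝ) : Set (Fin d → ℤ) :=
  {k | ∑ j, (k j : ℝ) ^ 2 = lam ^ 2}

theorem latticeSphere_finite (d : ℕ) (lam : ℝ) : (latticeSphere d lam).Finite := by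
  refine (Set.Finite.pi' (t := fun _ : Fin d => Set.Icc (-⌈|lam|⌉) ⌈|lam|⌉)
    (fun _ => Set.finite_Icc _ _)).subset ?_
  intro k hk j
  have h1 : (k j : ℝ) ^ 2 ≤ lam ^ 2 := by
    rw [← (show ∑ j, (k j : ℝ) ^ 2 = lam ^ 2 from hk)]
    exact Finset.single_le_sum (f := fun j => (k j : ℝ) ^ 2)
      (fun i _ => sq_nonneg _) (Finset.mem_univ j)
  have h2 : |(k j : ℝ)| ≤ |lam| := sq_le_sq.mp h1
  have h3 : |(k j : ℝ)| ≤ (⌈|lam|⌉ : ℝ) := h2.trans (Int.le_ceil _)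
  have h4 : |k j| ≤ ⌈|lam|⌉ := by exact_mod_cast h3
  exact abs_le.mp h4

/-- `𝓝_d(lam)`, the number of integer points on the sphere of radius `lam` (a finite number, by
`latticeSphere_finite`). -/
def latticeCount (d : ℕ) (lam : ℝ) : ℕ := (latticeSphere d lam).ncard

/-- The partial derivative `∂_j u`. -/
def partialDeriv {d : ℕ} (j : Fin d) (u : EuclideanSpace ℝ (Fin d) → ℂ) :
    EuclideanSpace ℝ (Fin d) → ℂ :=
  fun x => fderiv ℝ u x (EuclideanSpace.single j 1)

/-- The iterated partial derivative `∂^α u = ∂_1^{α_1} ⋯ ∂_d^{α_d} u`. -/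
def multiDeriv {d : ℕ} (α : Fin d → ℕ) (u : EuclideanSpace ℝ (Fin d) → ℂ) :
    EuclideanSpace ℝ (Fin d) → ℂ :=
  (List.finRange d).foldr (fun j v => (partialDeriv j)^[α j] v) u

/-- `u` vanishes to order `N` at the origin: `∂^α u(0) = 0` for all `|α| ≤ N`. -/
def VanishesToOrder {d : ℕ} (u : EuclideanSpace ℝ (Fin d) → ℂ) (N : ℕ) : Prop :=
  ∀ α : Fin d → ℕ, ∑ j, α j ≤ N → multiDeriv α u 0 = 0

/-- The order of vanishing `Γ(u)` at the origin: the largest `N ∈ ℕ` such that `u` vanishes to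
order `N`. It is `⊥` (that is, `-∞`) if there is no such `N`, i.e. if `u(0) ≠ 0`, and `⊤` if
all derivatives vanish. -/
def vanishingOrder {d : ℕ} (u : EuclideanSpace ℝ (Fin d) → ℂ) : EReal :=
  ⨆ (N : ℕ) (_ : VanishesToOrder u N), (N : EReal)

/-- The maximal order of vanishing `Γ_d(lam) = sup {Γ(u) : 0 ≠ u ∈ 𝓔_d(lam)}`. -/
def maxVanishingOrder (d : ℕ) (lam : ℝ) : EReal :=
  ⨆ (u : EuclideanSpace ℝ (Fin d) → ℂ) (_ : u ∈ eigenspace d lam) (_ : u ≠ 0), vanishingOrder u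

end

end TorusEigen

/-!
A trigonometric polynomial `∑ c_k exp(i k · x)` with frequencies on the sphere `|k| = lam` is an
eigenfunction, and it vanishes to order `N` at the origin iff the moments `∑ c_k k^α`, `|α| ≤ N`,
vanish. On the sphere `k₀²` is a polynomial in the other coordinates, so the moments with `α₀ ≤ 1`
are enough (`moment_eq_zero`). There are `(N + d - 1).choose (d - 1) + (N + d - 2).choose (d - 1)`
of them, and with more lattice points than equations a nonzero solution `c` exists
(`natCast_le_maxVanishingOrder`).

Write `D = d - 1` and `ρ` for the `D`-th root of the lattice point count. The two binomials are
together at most `(6 (N + D) / D) ^ D`, so for `ρ > 24` the criterion applies with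
`N = ⌈D ρ / 12⌉` (`le_maxVanishingOrder_of_large`). For `ρ ≤ 24` it is enough that the maximal
order of vanishing is at least `1`, which `cos(k · x) - cos(l · x)` shows for lattice points `k`
and `l ≠ ±k` (`one_le_maxVanishingOrder`). If the sphere has no lattice points, the right-hand side
is `0`, and the odd part of a nonzero eigenfunction about a suitable point gives the bound
(`zero_le_maxVanishingOrder`); this makes completeness of the exponentials unnecessary. An absolute
constant for large `lam` and every `d` needs that, for `d ≥ 5`, the lattice point count tends to
infinity.

This, and the bounds by powers of `lam`, follow from a lower bound of order `n ^ ((d - 2) / 2)` for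
the number of representations of `n` as a sum of `d ≥ 5` squares (`le_latticeCount`): with `d - 4`
variables in a box, in parity classes that leave an odd number `u ≥ n / 2`, there remain at least
`4 u` representations of `u` by four squares. The latter (`exists_four_squares_finset`) is
Dirichlet's argument. By unique factorization in `ℤ[i]`, up to units there are at least
`g(s) = ∑_{a ∣ s} χ₄(a)` Gaussian integers of norm `s` (`exists_transversal`), and
`∑_{s + t = 2 u} g(s) g(t)` over odd `s`, `t` is a sum of the signs `χ₄(α) χ₄(β)` over the positive
odd solutions of `α a + β b = 2 u`. A sign-reversing involution (`quadrupleInvolution`) cancels the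
terms with `α ≠ β`, and those with `α = β` number at least `u`.
-/

namespace TorusEigen

set_option autoImplicit false

/-! ### Gaussian integers of given norm -/

/-- `divisorCharSum s = ∑_{a ∣ s} χ₄(a)`, which for `s > 0` is the number of Gaussian integers of
norm `s` up to units. -/
def divisorCharSum (s : ℕ) : ℤ := ∑ a ∈ s.divisors, ZMod.χ₄ (a : ZMod 4)

theorem divisorCharSum_mul {m n : ℕ} (h : m.Coprime n) :
    divisorCharSum (m * n) = divisorCharSum m * divisorCharSum n := by
  set f : ArithmeticFunction ℤ := ⟨fun a => ZMod.χ₄ (a : ZMod 4), by simp⟩ with hf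
  have hm : f.IsMultiplicative := by
    refine ⟨by simp [hf], fun {m n} _ => ?_⟩
    simp only [hf, ArithmeticFunction.coe_mk, Nat.cast_mul, map_mul]
  have hg : ∀ s, divisorCharSum s = ((ArithmeticFunction.zeta : ArithmeticFunction ℤ) * f) s :=
    fun s => by rw [ArithmeticFunction.coe_zeta_mul_apply]; rfl
  simp only [hg]
  exact (ArithmeticFunction.isMultiplicative_zeta.natCast.mul hm).map_mul_of_coprime h

theorem divisorCharSum_prime_pow {p : ℕ} (hp : p.Prime) (k : ℕ) :
    divisorCharSum (p ^ k) = ∑ j ∈ Finset.range (k + 1), (ZMod.χ₄ (p : ZMod 4)) ^ j := by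
  unfold divisorCharSum
  rw [Nat.sum_divisors_prime_pow hp]
  simp only [Nat.cast_pow, map_pow]

theorem mul_star_eq_norm (z : GaussianInt) : z * star z = (z.norm : GaussianInt) :=
  (Zsqrtd.norm_eq_mul_conj z).symm

theorem isCoprime_of_norm {z w : GaussianInt} (h : IsCoprime z.norm w.norm) : IsCoprime z w := by
  have h1 : IsCoprime (z.norm : GaussianInt) (w.norm : GaussianInt) := h.map (Int.castRingHom GaussianInt)
  rw [← mul_star_eq_norm, ← mul_star_eq_norm] at h1
  exact h1.of_mul_left_left.of_mul_right_left

theorem associated_of_mul_associated_mul {m n : ℤ} (hmn : IsCoprime m n) {z w z' w' : GaussianInt}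
    (hz : z.norm = m) (hw : w.norm = n) (hz' : z'.norm = m) (hw' : w'.norm = n)
    (h : Associated (z * w) (z' * w')) : Associated z z' ∧ Associated w w' := by
  have h1 : IsCoprime z w' := isCoprime_of_norm (by rwa [hz, hw'])
  have h2 : IsCoprime z' w := isCoprime_of_norm (by rwa [hz', hw])
  constructor
  · apply associated_of_dvd_dvd
    · exact h1.dvd_of_dvd_mul_right ((dvd_mul_right z w).trans h.dvd)
    · exact h2.dvd_of_dvd_mul_right ((dvd_mul_right z' w').trans h.symm.dvd)
  · apply associated_of_dvd_dvd
    · exact h2.symm.dvd_of_dvd_mul_left ((dvd_mul_left w z).trans h.dvd)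
    · exact h1.symm.dvd_of_dvd_mul_left ((dvd_mul_left w' z').trans h.symm.dvd)

/-- `T` consists of pairwise non-associated Gaussian integers of norm `s`. Not every class of
associated elements of norm `s` has to be represented. -/
def IsNormTransversal (s : ℕ) (T : Finset GaussianInt) : Prop :=
  (∀ z ∈ T, z.norm = s) ∧ ∀ z ∈ T, ∀ w ∈ T, Associated z w → z = w

/-- If `p = π π̄` with `p ≡ 1 (mod 4)`, then `π` and `π̄` are coprime, so the `k + 1` elements
`π ^ i π̄ ^ (k - i)` of norm `p ^ k` are pairwise non-associated. -/
theorem exists_transversal_prime_pow_of_one {p : ℕ} (hp : p.Prime) (h : p % 4 = 1) (k : ℕ) :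
    ∃ T, IsNormTransversal (p ^ k) T ∧ T.card = k + 1 := by
  classical
  have := Fact.mk hp
  obtain ⟨a, b, hab⟩ := Nat.Prime.sq_add_sq (p := p) (by omega)
  set π : GaussianInt := ⟨a, b⟩ with hπ
  have hn : π.norm = p := by
    rw [Zsqrtd.norm_def, ← hab]; push_cast; ring
  have hn' : (star π).norm = p := by rw [Zsqrtd.norm_conj, hn]
  -- an ideal with `π` and `π̄` contains `p = π π̄` and `2 a = π + π̄`, which are coprime integers
  have hcop : IsCoprime π (star π) := by
    have h0 : IsCoprime (p : ℤ) (2 * a : ℤ) := by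
      have : Nat.Coprime p (2 * a) := by
        rw [hp.coprime_iff_not_dvd, hp.dvd_mul, not_or]
        constructor
        · intro h2
          have := Nat.le_of_dvd (by norm_num) h2
          have := hp.two_le
          omega
        · intro ha
          have ha0 : a ≠ 0 := by
            rintro rfl
            have : IsSquare p := ⟨b, by nlinarith⟩
            exact hp.prime.irreducible.not_isSquare this
          have := Nat.le_of_dvd (by omega) ha
          have := hp.two_le
          nlinarith [Nat.zero_le (b ^ 2)]
      exact_mod_cast Nat.isCoprime_iff_coprime.2 this
    obtain ⟨x, y, hxy⟩ := h0
    have e1 : (p : GaussianInt) = π * star π := by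
      rw [mul_star_eq_norm, hn]; simp
    have e2 : (2 * a : GaussianInt) = π + star π := by
      ext <;> simp [hπ]; ring
    have e3 : (x : GaussianInt) * p + y * (2 * a) = 1 := by exact_mod_cast congrArg (Int.cast : ℤ → GaussianInt) hxy
    refine ⟨x * star π + y, y, ?_⟩
    rw [e1, e2] at e3
    rw [← e3]; ring
  have key : ∀ i j, i < j → j ≤ k →
      ¬ Associated (π ^ i * star π ^ (k - i)) (π ^ j * star π ^ (k - j)) := by
    intro i j hij hjk hass
    have hd : π ^ j ∣ π ^ i * star π ^ (k - i) := (dvd_mul_right _ _).trans hass.symm.dvd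
    have hπ0 : π ^ i ≠ 0 := pow_ne_zero _ (by
      intro h0; rw [h0] at hn; simp at hn; exact hp.ne_zero (by exact_mod_cast hn.symm))
    rw [show j = i + (j - i) by omega, pow_add] at hd
    have hd' := (mul_dvd_mul_iff_left hπ0).1 hd
    have hu : IsUnit (π ^ (j - i)) :=
      (hcop.pow (m := j - i) (n := k - i)).isUnit_of_dvd' dvd_rfl hd'
    have hu' : IsUnit π := (isUnit_pow_iff (by omega)).1 hu
    have := Zsqrtd.norm_eq_one_iff.2 hu'
    rw [hn] at this
    simp at this
    exact hp.one_lt.ne' this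
  have hkey : ∀ i ∈ Finset.range (k + 1), ∀ j ∈ Finset.range (k + 1),
      Associated (π ^ i * star π ^ (k - i)) (π ^ j * star π ^ (k - j)) → i = j := by
    intro i hi j hj hass
    simp only [Finset.mem_range] at hi hj
    rcases lt_trichotomy i j with hij | hij | hij
    · exact absurd hass (key i j hij (by omega))
    · exact hij
    · exact absurd hass.symm (key j i hij (by omega))
  refine ⟨(Finset.range (k + 1)).image fun i => π ^ i * star π ^ (k - i), ⟨?_, ?_⟩, ?_⟩
  · intro z hz
    obtain ⟨i, hi, rfl⟩ := Finset.mem_image.1 hz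
    simp only [Finset.mem_range] at hi
    have hpow : ∀ (w : GaussianInt) (l : ℕ), (w ^ l).norm = w.norm ^ l := fun w l =>
      map_pow (Zsqrtd.normMonoidHom (d := -1)) w l
    rw [Zsqrtd.norm_mul, hpow, hpow, hn, hn', ← pow_add, show i + (k - i) = k by omega]
    push_cast; rfl
  · intro z hz w hw hass
    obtain ⟨i, hi, rfl⟩ := Finset.mem_image.1 hz
    obtain ⟨j, hj, rfl⟩ := Finset.mem_image.1 hw
    rw [hkey i hi j hj hass]
  · rw [Finset.card_image_of_injOn, Finset.card_range]
    intro i hi j hj hij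
    exact hkey i hi j hj (by simp only at hij; rw [hij])

theorem exists_transversal_prime_pow {p : ℕ} (hp : p.Prime) (k : ℕ) :
    ∃ T, IsNormTransversal (p ^ k) T ∧ (T.card : ℤ) = divisorCharSum (p ^ k) := by
  have hsingle : ∀ (z : GaussianInt) (s : ℕ), z.norm = s → IsNormTransversal s {z} := by
    intro z s hz
    constructor <;> simp_all
  have hpow : ∀ (w : GaussianInt) (l : ℕ), (w ^ l).norm = w.norm ^ l := fun w l =>
      map_pow (Zsqrtd.normMonoidHom (d := -1)) w l
  rw [divisorCharSum_prime_pow hp]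
  have h4 : p = 2 ∨ p % 4 = 1 ∨ p % 4 = 3 := by
    rcases hp.eq_two_or_odd with h | h
    · exact Or.inl h
    · omega
  rcases h4 with rfl | h | h
  · refine ⟨{(⟨1, 1⟩ : GaussianInt) ^ k}, hsingle _ _ ?_, ?_⟩
    · rw [hpow]; simp [Zsqrtd.norm_def]
    · rw [show ZMod.χ₄ ((2 : ℕ) : ZMod 4) = 0 by decide]
      simp [Finset.sum_range_succ']
  · obtain ⟨T, hT, hc⟩ := exists_transversal_prime_pow_of_one hp h k
    refine ⟨T, hT, ?_⟩
    rw [hc, ZMod.χ₄_nat_one_mod_four h]; simp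
  · rw [ZMod.χ₄_nat_three_mod_four h, neg_one_geom_sum]
    rcases Nat.even_or_odd k with hk | hk
    · obtain ⟨l, rfl⟩ := hk
      refine ⟨{(p : GaussianInt) ^ l}, hsingle _ _ ?_, ?_⟩
      · rw [hpow, Zsqrtd.norm_natCast]; push_cast; ring
      · simp [Nat.even_add_one]
    · refine ⟨∅, by constructor <;> simp, ?_⟩
      simp [hk.add_one]

/-- The number of Gaussian integers of norm `s`, up to units, is at least `∑_{a ∣ s} χ₄(a)`. -/
theorem exists_transversal (s : ℕ) (hs : 0 < s) :
    ∃ T, IsNormTransversal s T ∧ (T.card : ℤ) = divisorCharSum s := by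
  classical
  induction s using Nat.recOnPosPrimePosCoprime with
  | prime_pow p n hp hn => exact exists_transversal_prime_pow hp n
  | zero => omega
  | one => 
    have := exists_transversal_prime_pow Nat.prime_two 0
    simpa using this
  | coprime a b ha hb hab iha ihb =>
    obtain ⟨T, hT, hTc⟩ := iha (by omega)
    obtain ⟨U, hU, hUc⟩ := ihb (by omega)
    have hcop : IsCoprime (a : ℤ) (b : ℤ) := Nat.isCoprime_iff_coprime.2 hab
    have key : ∀ z ∈ T, ∀ w ∈ U, ∀ z' ∈ T, ∀ w' ∈ U, Associated (z * w) (z' * w') →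
        z = z' ∧ w = w' := by
      intro z hz w hw z' hz' w' hw' hass
      have := associated_of_mul_associated_mul hcop (hT.1 z hz) (hU.1 w hw) (hT.1 z' hz')
        (hU.1 w' hw') hass
      exact ⟨hT.2 _ hz _ hz' this.1, hU.2 _ hw _ hw' this.2⟩
    refine ⟨(T ×ˢ U).image fun q => q.1 * q.2, ⟨?_, ?_⟩, ?_⟩
    · intro z hz
      obtain ⟨q, hq, rfl⟩ := Finset.mem_image.1 hz
      rw [Finset.mem_product] at hq
      rw [Zsqrtd.norm_mul, hT.1 _ hq.1, hU.1 _ hq.2]; push_cast; rfl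
    · intro z hz w hw hass
      obtain ⟨q, hq, rfl⟩ := Finset.mem_image.1 hz
      obtain ⟨r, hr, rfl⟩ := Finset.mem_image.1 hw
      rw [Finset.mem_product] at hq hr
      obtain ⟨h1, h2⟩ := key _ hq.1 _ hq.2 _ hr.1 _ hr.2 hass
      rw [h1, h2]
    · rw [Finset.card_image_of_injOn, Finset.card_product, divisorCharSum_mul hab, ← hTc, ← hUc]
      · push_cast; rfl
      · rintro ⟨z, w⟩ hq ⟨z', w'⟩ hr h
        simp only [Finset.coe_product, Set.mem_prod, Finset.mem_coe] at hq hr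
        simp only at h
        obtain ⟨h1, h2⟩ := key _ hq.1 _ hq.2 _ hr.1 _ hr.2 (by rw [h])
        rw [h1, h2]

theorem divisorCharSum_nonneg (s : ℕ) : 0 ≤ divisorCharSum s := by
  rcases Nat.eq_zero_or_pos s with rfl | hs
  · simp [divisorCharSum]
  · obtain ⟨T, -, hT⟩ := exists_transversal s hs
    rw [← hT]; positivity

/-- For odd `s`, each class of associated Gaussian integers of norm `s` has two members with odd
real part. -/
theorem exists_odd_re_norm_eq (s : ℕ) (hs : Odd s) :
    ∃ B : Finset GaussianInt, (∀ z ∈ B, z.norm = s ∧ Odd z.re) ∧ 2 * divisorCharSum s ≤ B.card := by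
  classical
  obtain ⟨T, hT, hc⟩ := exists_transversal s hs.pos
  set ρ : GaussianInt → GaussianInt := fun z => if Odd z.re then z else z * ⟨0, 1⟩ with hρ
  have hI : Associated (1 : GaussianInt) ⟨0, 1⟩ :=
    ⟨⟨⟨0, 1⟩, ⟨0, -1⟩, by ext <;> simp, by ext <;> simp⟩, by simp⟩
  have hass : ∀ z, Associated z (ρ z) := by
    intro z
    simp only [hρ]
    split_ifs
    · rfl
    · simpa using hI.mul_left z
  have hodd : ∀ z ∈ T, (ρ z).norm = s ∧ Odd (ρ z).re := by
    intro z hz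
    have h1 := hT.1 z hz
    simp only [hρ]
    split_ifs with h
    · exact ⟨h1, h⟩
    · refine ⟨by rw [Zsqrtd.norm_mul, h1]; simp [Zsqrtd.norm_def], ?_⟩
      have h2 : Odd (z.norm) := by rw [h1]; exact_mod_cast hs
      rw [Zsqrtd.norm_def] at h2
      rw [Int.not_odd_iff_even] at h
      have : Odd z.im := by
        by_contra h3
        rw [Int.not_odd_iff_even] at h3
        rw [← Int.not_even_iff_odd] at h2
        apply h2
        simp [Int.even_add, h, h3, parity_simps]
      simpa using this.neg
  refine ⟨T.image ρ ∪ T.image (fun z => - ρ z), ?_, ?_⟩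
  · intro z hz
    simp only [Finset.mem_union, Finset.mem_image] at hz
    rcases hz with ⟨w, hw, rfl⟩ | ⟨w, hw, rfl⟩
    · exact hodd w hw
    · obtain ⟨h1, h2⟩ := hodd w hw
      exact ⟨by simpa using h1, by simpa using h2⟩
  · have hinj : ∀ z ∈ T, ∀ w ∈ T, ρ z = ρ w ∨ ρ z = - ρ w → z = w := by
      intro z hz w hw h
      apply hT.2 z hz w hw
      refine (hass z).trans (Associated.trans ?_ (hass w).symm)
      rcases h with h | h
      · rw [h]
      · rw [h]; exact Associated.neg_left (Associated.refl _)
    rw [Finset.card_union_of_disjoint, Finset.card_image_of_injOn, Finset.card_image_of_injOn]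
    · push_cast; rw [hc]; linarith
    · intro z hz w hw h
      exact hinj z hz w hw (Or.inl (by simpa using h))
    · intro z hz w hw h
      exact hinj z hz w hw (Or.inl h)
    · rw [Finset.disjoint_left]
      intro x hx hy
      obtain ⟨z, hz, rfl⟩ := Finset.mem_image.1 hx
      obtain ⟨w, hw, h⟩ := Finset.mem_image.1 hy
      obtain rfl := hinj z hz w hw (Or.inr h.symm)
      have h2 : (ρ z).re = 0 := by
        have := congrArg Zsqrtd.re h
        simp at this; omega
      have := (hodd z hz).2
      rw [h2] at this
      simp at this

/-! ### Dirichlet's convolution identity -/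

/-- The quadruples `(α, a, β, b)` of positive odd integers with `α a + β b = 2 u`. -/
noncomputable def oddQuadruples (u : ℕ) : Finset (ℤ × ℤ × ℤ × ℤ) :=
  (Finset.Icc 1 (2 * u : ℤ) ×ˢ Finset.Icc 1 (2 * u : ℤ) ×ˢ Finset.Icc 1 (2 * u : ℤ) ×ˢ
    Finset.Icc 1 (2 * u : ℤ)).filter fun q =>
    (Odd q.1 ∧ Odd q.2.1 ∧ Odd q.2.2.1 ∧ Odd q.2.2.2) ∧
      q.1 * q.2.1 + q.2.2.1 * q.2.2.2 = 2 * u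

theorem mem_oddQuadruples {u : ℕ} {α a β b : ℤ} :
    (α, a, β, b) ∈ oddQuadruples u ↔ (0 < α ∧ 0 < a ∧ 0 < β ∧ 0 < b) ∧
      (Odd α ∧ Odd a ∧ Odd β ∧ Odd b) ∧ α * a + β * b = 2 * u := by
  simp only [oddQuadruples, Finset.mem_filter, Finset.mem_product, Finset.mem_Icc]
  constructor
  · rintro ⟨h, h1, h2⟩
    exact ⟨by omega, h1, h2⟩
  · rintro ⟨⟨h1, h2, h3, h4⟩, h5, h6⟩
    refine ⟨?_, h5, h6⟩
    have := mul_pos h1 h2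
    have := mul_pos h3 h4
    refine ⟨⟨by omega, ?_⟩, ⟨by omega, ?_⟩, ⟨by omega, ?_⟩, ⟨by omega, ?_⟩⟩ <;> nlinarith

/-- The sign `χ₄(α) χ₄(β)` of a quadruple `(α, a, β, b)`. -/
def quadrupleSign (q : ℤ × ℤ × ℤ × ℤ) : ℤ := ZMod.χ₄ (q.1 : ZMod 4) * ZMod.χ₄ (q.2.2.1 : ZMod 4)

theorem chi_mul_chi_of_odd {x y : ℤ} (hx : Odd x) (hy : Odd y) :
    ZMod.χ₄ (x : ZMod 4) * ZMod.χ₄ (y : ZMod 4) = if (x - y) % 4 = 0 then 1 else -1 := by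
  rw [ZMod.χ₄_int_eq_if_mod_four, ZMod.χ₄_int_eq_if_mod_four]
  rw [Int.odd_iff] at hx hy
  split_ifs <;> first | rfl | omega

/-- Dirichlet's involution on the quadruples `(α, a, β, b)` with `β < α`. It exchanges the
differences `α - β` with the sums `a + b` and keeps `n = ⌊β / (α - β)⌋`. -/
def quadrupleInvolution (q : ℤ × ℤ × ℤ × ℤ) : ℤ × ℤ × ℤ × ℤ :=
  let n := q.2.2.1 / (q.1 - q.2.2.1)
  ((n + 2) * q.2.1 + (n + 1) * q.2.2.2, (n + 1) * q.2.2.1 - n * q.1,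
    (n + 1) * q.2.1 + n * q.2.2.2, (n + 1) * q.1 - (n + 2) * q.2.2.1)

/-- The terms with `β < α` cancel: since `α a + β b ≡ 2 (mod 4)`, exactly one of `α - β` and
`a + b` is divisible by `4`, so the involution reverses the sign. -/
theorem sum_quadrupleSign_gt {u : ℕ} (hu : Odd u) :
    ∑ q ∈ (oddQuadruples u).filter (fun q => q.2.2.1 < q.1), quadrupleSign q = 0 := by
  -- the first inequality for `n` is strict because `β` is odd and `α - β` is even
  have hn : ∀ {α β : ℤ}, 0 < β → β < α → Odd α → Odd β →
      0 ≤ β / (α - β) ∧ (β / (α - β)) * (α - β) < β ∧ β < (β / (α - β) + 1) * (α - β) := by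
    intro α β hβ hαβ ho1 ho2
    have hpos : 0 < α - β := by omega
    refine ⟨Int.ediv_nonneg hβ.le hpos.le, ?_, Int.lt_ediv_add_one_mul_self _ hpos⟩
    refine lt_of_le_of_ne (Int.ediv_mul_le _ hpos.ne') ?_
    intro h
    have h1 : Even ((β / (α - β)) * (α - β)) := (ho1.sub_odd ho2).mul_left _
    rw [h, ← Int.not_odd_iff_even] at h1
    exact h1 ho2
  have hparity : ∀ {α a β b : ℤ}, Odd α → Odd a → Odd β → Odd b → α * a + β * b = 2 * u →
      ((α - β) % 4 = 0 ↔ ¬ (a + b) % 4 = 0) := by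
    rintro α a β b ⟨x, rfl⟩ ⟨y, rfl⟩ ⟨z, rfl⟩ ⟨w, rfl⟩ h
    obtain ⟨v, rfl⟩ := hu
    push_cast at h
    have h2 : x + y + z + w + 2 * (x * y + z * w) = 2 * v := by linarith
    have h1 : (x + y + z + w) % 2 = 0 := by omega
    omega
  have hmem : ∀ q ∈ (oddQuadruples u).filter (fun q => q.2.2.1 < q.1),
      quadrupleInvolution q ∈ (oddQuadruples u).filter (fun q => q.2.2.1 < q.1) := by
    rintro ⟨α, a, β, b⟩ hq
    simp only [Finset.mem_filter, mem_oddQuadruples] at hq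
    obtain ⟨⟨⟨h1, h2, h3, h4⟩, ⟨o1, o2, o3, o4⟩, hs⟩, hlt⟩ := hq
    obtain ⟨hn0, hn1, hn2⟩ := hn h3 hlt o1 o3
    simp only [quadrupleInvolution]
    generalize β / (α - β) = n at hn0 hn1 hn2
    simp only [Finset.mem_filter, mem_oddQuadruples]
    refine ⟨⟨⟨by positivity, by linarith, by positivity, by linarith⟩, ⟨?_, ?_, ?_, ?_⟩, ?_⟩, ?_⟩
    · obtain ⟨y, rfl⟩ := o2
      obtain ⟨w, rfl⟩ := o4
      exact ⟨n * y + 2 * y + n * w + w + n + 1, by ring⟩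
    · obtain ⟨x, rfl⟩ := o1
      obtain ⟨z, rfl⟩ := o3
      exact ⟨n * z + z - n * x, by ring⟩
    · obtain ⟨y, rfl⟩ := o2
      obtain ⟨w, rfl⟩ := o4
      exact ⟨n * y + y + n * w + n, by ring⟩
    · obtain ⟨x, rfl⟩ := o1
      obtain ⟨z, rfl⟩ := o3
      exact ⟨n * x + x - n * z - 2 * z - 1, by ring⟩
    · rw [← hs]; ring
    · linarith
  refine Finset.sum_involution (fun q _ => quadrupleInvolution q) ?_ ?_ hmem ?_
  · rintro ⟨α, a, β, b⟩ hq
    have hq' := hmem _ hq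
    have hd : ((quadrupleInvolution (α, a, β, b)).1 -
        (quadrupleInvolution (α, a, β, b)).2.2.1) = a + b := by
      simp only [quadrupleInvolution]; ring
    generalize quadrupleInvolution (α, a, β, b) = r at hq' hd
    obtain ⟨α', a', β', b'⟩ := r
    simp only [Finset.mem_filter, mem_oddQuadruples] at hq hq'
    obtain ⟨⟨-, ⟨o1, o2, o3, o4⟩, hs⟩, -⟩ := hq
    obtain ⟨⟨-, ⟨o1', -, o3', -⟩, -⟩, -⟩ := hq'
    simp only [quadrupleSign] at hd ⊢
    rw [chi_mul_chi_of_odd o1 o3, chi_mul_chi_of_odd o1' o3', hd]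
    have := hparity o1 o2 o3 o4 hs
    split_ifs <;> simp_all
  · rintro ⟨α, a, β, b⟩ hq - heq
    have hd : ((quadrupleInvolution (α, a, β, b)).1 -
        (quadrupleInvolution (α, a, β, b)).2.2.1) = a + b := by
      simp only [quadrupleInvolution]; ring
    rw [heq] at hd
    simp only [Finset.mem_filter, mem_oddQuadruples] at hq
    obtain ⟨⟨-, ⟨o1, o2, o3, o4⟩, hs⟩, -⟩ := hq
    have := hparity o1 o2 o3 o4 hs
    simp only at hd
    rw [hd] at this
    tauto
  · rintro ⟨α, a, β, b⟩ hq
    simp only [Finset.mem_filter, mem_oddQuadruples] at hq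
    obtain ⟨⟨⟨h1, h2, h3, h4⟩, ⟨o1, o2, o3, o4⟩, hs⟩, hlt⟩ := hq
    obtain ⟨hn0, hn1, hn2⟩ := hn h3 hlt o1 o3
    simp only [quadrupleInvolution]
    generalize β / (α - β) = n at hn0 hn1 hn2
    have hn' : ((n + 1) * a + n * b) / ((n + 2) * a + (n + 1) * b - ((n + 1) * a + n * b)) = n := by
      rw [show (n + 2) * a + (n + 1) * b - ((n + 1) * a + n * b) = a + b by ring,
        show (n + 1) * a + n * b = a + (a + b) * n by ring,
        Int.add_mul_ediv_left _ _ (by omega : a + b ≠ 0),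
        Int.ediv_eq_zero_of_lt h2.le (by omega), zero_add]
    rw [hn']
    ext <;> simp only <;> ring

/-- Only the diagonal `α = β` contributes to the sum of the signs; its terms are `1`, and those with
`α = β = 1` already number `u`. -/
theorem le_sum_quadrupleSign {u : ℕ} (hu : Odd u) :
    (u : ℤ) ≤ ∑ q ∈ oddQuadruples u, quadrupleSign q := by
  classical
  rw [← Finset.sum_filter_add_sum_filter_not _ (fun q => q.2.2.1 < q.1),
    sum_quadrupleSign_gt hu, zero_add,
    ← Finset.sum_filter_add_sum_filter_not _ (fun q => q.1 < q.2.2.1)]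
  have h1 : ∑ q ∈ ((oddQuadruples u).filter (fun q => ¬ q.2.2.1 < q.1)).filter
      (fun q => q.1 < q.2.2.1), quadrupleSign q = 0 := by
    rw [← sum_quadrupleSign_gt hu]
    refine Finset.sum_nbij' (fun q => (q.2.2.1, q.2.2.2, q.1, q.2.1))
      (fun q => (q.2.2.1, q.2.2.2, q.1, q.2.1)) ?_ ?_ ?_ ?_ ?_
    · rintro ⟨α, a, β, b⟩ hq
      simp only [Finset.mem_filter, mem_oddQuadruples] at hq ⊢
      refine ⟨⟨by tauto, by tauto, by linarith [hq.1.1.2.2]⟩, hq.2⟩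
    · rintro ⟨α, a, β, b⟩ hq
      simp only [Finset.mem_filter, mem_oddQuadruples] at hq ⊢
      refine ⟨⟨⟨by tauto, by tauto, by linarith [hq.1.2.2]⟩, by omega⟩, hq.2⟩
    · rintro ⟨α, a, β, b⟩ _; rfl
    · rintro ⟨α, a, β, b⟩ _; rfl
    · rintro ⟨α, a, β, b⟩ _
      simp only [quadrupleSign]; ring
  rw [h1, zero_add]
  have hone : ∀ q ∈ ((oddQuadruples u).filter (fun q => ¬ q.2.2.1 < q.1)).filter
      (fun q => ¬ q.1 < q.2.2.1), quadrupleSign q = 1 := by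
    rintro ⟨α, a, β, b⟩ hq
    simp only [Finset.mem_filter, mem_oddQuadruples] at hq
    simp only [quadrupleSign]
    rw [chi_mul_chi_of_odd hq.1.1.2.1.1 hq.1.1.2.1.2.2.1, if_pos (by omega)]
  rw [Finset.sum_congr rfl hone, Finset.sum_const, nsmul_one]
  have hcard : u ≤ (((oddQuadruples u).filter (fun q => ¬ q.2.2.1 < q.1)).filter
      (fun q => ¬ q.1 < q.2.2.1)).card := by
    rw [← Finset.card_range u]
    refine Finset.card_le_card_of_injOn
      (fun t : ℕ => ((1, 2 * t + 1, 1, 2 * u - 2 * t - 1) : ℤ × ℤ × ℤ × ℤ)) ?_ ?_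
    · intro t ht
      simp only [Finset.coe_range, Set.mem_Iio] at ht
      simp only [Finset.card_range, Finset.coe_filter, Set.mem_ofPred_eq, Finset.mem_filter,
        mem_oddQuadruples]
      refine ⟨⟨⟨by omega, ⟨by decide, ⟨t, rfl⟩, by decide, ⟨u - t - 1, by ring⟩⟩, by ring⟩,
        by omega⟩, by omega⟩
    · intro t _ t' _ h
      simp only [Prod.mk.injEq] at h
      omega
  exact_mod_cast hcard

/-- Dirichlet's convolution identity, as a lower bound: over odd `s`, the products expand to the sum
of the signs of the quadruples with `α a = s` and `β b = 2 u - s`. -/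
theorem le_sum_divisorCharSum_mul {u : ℕ} (hu : Odd u) :
    (u : ℤ) ≤ ∑ s ∈ (Finset.range (2 * u)).filter Odd,
      divisorCharSum s * divisorCharSum (2 * u - s) := by
  classical
  refine (le_sum_quadrupleSign hu).trans_eq ?_
  simp only [divisorCharSum, Finset.sum_mul_sum, ← Finset.sum_product']
  rw [Finset.sum_sigma']
  refine Finset.sum_nbij'
    (fun q => (⟨(q.1 * q.2.1).toNat, (q.1.toNat, q.2.2.1.toNat)⟩ : Σ _ : ℕ, ℕ × ℕ))
    (fun r => (((r.2.1 : ℕ) : ℤ), ((r.1 / r.2.1 : ℕ) : ℤ), ((r.2.2 : ℕ) : ℤ),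
      (((2 * u - r.1) / r.2.2 : ℕ) : ℤ))) ?_ ?_ ?_ ?_ ?_
  · rintro ⟨α, a, β, b⟩ hq
    rw [mem_oddQuadruples] at hq
    obtain ⟨⟨h1, h2, h3, h4⟩, ⟨o1, o2, o3, o4⟩, hs⟩ := hq
    lift α to ℕ using h1.le
    lift a to ℕ using h2.le
    lift β to ℕ using h3.le
    lift b to ℕ using h4.le
    have hs' : α * a + β * b = 2 * u := by exact_mod_cast hs
    have hp : 0 < β * b := by exact_mod_cast mul_pos h3 h4
    have hp' : 0 < α * a := by exact_mod_cast mul_pos h1 h2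
    simp only [Finset.mem_sigma, Finset.mem_filter, Finset.mem_range, Finset.mem_product,
      Nat.mem_divisors, Int.toNat_natCast, ← Nat.cast_mul]
    refine ⟨⟨by omega, ?_⟩, ⟨dvd_mul_right _ _, hp'.ne'⟩, ?_, by omega⟩
    · exact_mod_cast o1.mul o2
    · rw [← hs', Nat.add_sub_cancel_left]; exact dvd_mul_right _ _
  · rintro ⟨s, α, β⟩ hq
    simp only [Finset.mem_sigma, Finset.mem_filter, Finset.mem_range, Finset.mem_product,
      Nat.mem_divisors] at hq
    obtain ⟨⟨h1, h2⟩, ⟨⟨a, ha⟩, h4⟩, ⟨b, hb⟩, h6⟩ := hq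
    have hev : Odd (2 * u - s) := Nat.Even.sub_odd h1.le (even_two_mul u) h2
    have hα : 0 < α := by
      rcases Nat.eq_zero_or_pos α with rfl | h
      · simp at ha; omega
      · exact h
    have hβ : 0 < β := by
      rcases Nat.eq_zero_or_pos β with rfl | h
      · simp at hb; omega
      · exact h
    have ha0 : 0 < a := by
      rcases Nat.eq_zero_or_pos a with rfl | h
      · simp at ha; omega
      · exact h
    have hb0 : 0 < b := by
      rcases Nat.eq_zero_or_pos b with rfl | h
      · simp at hb; omega
      · exact h
    simp only
    rw [mem_oddQuadruples, hb, Nat.mul_div_cancel_left _ hβ, ha, Nat.mul_div_cancel_left _ hα]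
    rw [hb] at hev
    rw [ha] at h2
    rw [Nat.odd_mul] at hev h2
    refine ⟨by simp only [Nat.cast_pos]; exact ⟨hα, ha0, hβ, hb0⟩,
      by simp only [Int.odd_coe_nat]; exact ⟨h2.1, h2.2, hev.1, hev.2⟩, ?_⟩
    have : α * a + β * b = 2 * u := by rw [← ha, ← hb]; omega
    exact_mod_cast this
  · rintro ⟨α, a, β, b⟩ hq
    rw [mem_oddQuadruples] at hq
    obtain ⟨⟨h1, h2, h3, h4⟩, -, hs⟩ := hq
    lift α to ℕ using h1.le
    lift a to ℕ using h2.le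
    lift β to ℕ using h3.le
    lift b to ℕ using h4.le
    have hs' : α * a + β * b = 2 * u := by exact_mod_cast hs
    simp only [Int.toNat_natCast, ← Nat.cast_mul]
    rw [← hs', Nat.add_sub_cancel_left, Nat.mul_div_cancel_left _ (by exact_mod_cast h1),
      Nat.mul_div_cancel_left _ (by exact_mod_cast h3)]
  · rintro ⟨s, α, β⟩ hq
    simp only [Finset.mem_sigma, Finset.mem_filter, Finset.mem_range, Finset.mem_product,
      Nat.mem_divisors] at hq
    simp only [Int.toNat_natCast, ← Nat.cast_mul]
    rw [Nat.mul_div_cancel' hq.2.1.1]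
  · rintro ⟨α, a, β, b⟩ hq
    rw [mem_oddQuadruples] at hq
    obtain ⟨⟨h1, h2, h3, h4⟩, -, hs⟩ := hq
    lift α to ℕ using h1.le
    lift β to ℕ using h3.le
    simp [quadrupleSign]

/-! ### Lower bounds for sums of squares -/

/-- An odd number `u` has at least `4 u` representations as a sum of four squares: two Gaussian
integers `z`, `w` with odd real parts and `N z + N w = 2 u` give the representation by the half
sums and half differences of their coordinates. -/
theorem exists_four_squares_finset {u : ℕ} (hu : Odd u) :
    ∃ F : Finset (Fin 4 → ℤ), (∀ q ∈ F, ∑ i, q i ^ 2 = u) ∧ 4 * u ≤ F.card := by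
  classical
  have hB := exists_odd_re_norm_eq
  choose! B hB1 hB2 using hB
  set P : Finset (Σ _ : ℕ, GaussianInt × GaussianInt) :=
    ((Finset.range (2 * u)).filter Odd).sigma fun s => B s ×ˢ B (2 * u - s) with hP
  set f : (Σ _ : ℕ, GaussianInt × GaussianInt) → Fin 4 → ℤ := fun r =>
    ![(r.2.1.re + r.2.2.re) / 2, (r.2.1.re - r.2.2.re) / 2,
      (r.2.1.im + r.2.2.im) / 2, (r.2.1.im - r.2.2.im) / 2] with hf
  have key : ∀ r ∈ P, ∃ x y x' y' : ℤ, r.2.1 = ⟨2 * x + 1, 2 * y⟩ ∧ r.2.2 = ⟨2 * x' + 1, 2 * y'⟩ ∧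
      (2 * x + 1) ^ 2 + (2 * y) ^ 2 = r.1 ∧
      (2 * x + 1) ^ 2 + (2 * y) ^ 2 + ((2 * x' + 1) ^ 2 + (2 * y') ^ 2) = 2 * u := by
    have aux : ∀ (z : GaussianInt) (s : ℕ), Odd s → z.norm = s → Odd z.re →
        ∃ x y : ℤ, z = ⟨2 * x + 1, 2 * y⟩ ∧ (2 * x + 1) ^ 2 + (2 * y) ^ 2 = s := by
      rintro ⟨a, b⟩ s hs hn ⟨x, hx⟩
      simp only at hx
      subst hx
      rw [Zsqrtd.norm_def] at hn
      have hb : Even b := by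
        by_contra hb
        rw [Int.not_even_iff_odd] at hb
        obtain ⟨y, rfl⟩ := hb
        obtain ⟨v, rfl⟩ := hs
        push_cast at hn
        have : 2 * (2 * x ^ 2 + 2 * x + 2 * y ^ 2 + 2 * y + 1) = 2 * (v : ℤ) + 1 := by
          linarith
        omega
      obtain ⟨y, rfl⟩ := hb
      refine ⟨x, y, by rw [two_mul y], ?_⟩
      rw [← hn]; ring
    rintro ⟨s, z, w⟩ hr
    simp only [hP, Finset.mem_sigma, Finset.mem_filter, Finset.mem_range,
      Finset.mem_product] at hr
    obtain ⟨⟨hlt, hs⟩, hz, hw⟩ := hr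
    have hs' : Odd (2 * u - s) := Nat.Even.sub_odd hlt.le (even_two_mul u) hs
    obtain ⟨x, y, h1, h2⟩ := aux z s hs (hB1 s hs z hz).1 (hB1 s hs z hz).2
    obtain ⟨x', y', h3, h4⟩ := aux w _ hs' (hB1 _ hs' w hw).1 (hB1 _ hs' w hw).2
    refine ⟨x, y, x', y', h1, h3, h2, ?_⟩
    rw [h2, h4, Nat.cast_sub hlt.le]
    push_cast
    ring
  have hval : ∀ x y x' y' : ℤ, ![((2 * x + 1) + (2 * x' + 1)) / 2, ((2 * x + 1) - (2 * x' + 1)) / 2,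
      (2 * y + 2 * y') / 2, (2 * y - 2 * y') / 2] = ![x + x' + 1, x - x', y + y', y - y'] := by
    intro x y x' y'
    congr 1
    · omega
    congr 1
    · omega
    congr 1
    · omega
    congr 1
    · omega
  refine ⟨P.image f, ?_, ?_⟩
  · intro q hq
    obtain ⟨r, hr, rfl⟩ := Finset.mem_image.1 hq
    obtain ⟨x, y, x', y', h1, h2, -, h4⟩ := key r hr
    simp only [hf, h1, h2, hval, Fin.sum_univ_four]
    simp only [Matrix.cons_val]
    linarith
  · rw [Finset.card_image_of_injOn]
    · rw [hP, Finset.card_sigma]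
      have h := le_sum_divisorCharSum_mul hu
      have h' : ∑ s ∈ (Finset.range (2 * u)).filter Odd,
          4 * (divisorCharSum s * divisorCharSum (2 * u - s)) ≤
          ∑ s ∈ (Finset.range (2 * u)).filter Odd, ((B s ×ˢ B (2 * u - s)).card : ℤ) := by
        refine Finset.sum_le_sum fun s hs => ?_
        simp only [Finset.mem_filter, Finset.mem_range] at hs
        have hs' : Odd (2 * u - s) := Nat.Even.sub_odd hs.1.le (even_two_mul u) hs.2
        rw [Finset.card_product]
        push_cast
        have := mul_le_mul (hB2 s hs.2) (hB2 _ hs')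
          (mul_nonneg zero_le_two (divisorCharSum_nonneg _)) (by positivity)
        linarith
      rw [← Finset.mul_sum] at h'
      zify
      linarith
    · intro r hr r' hr' h
      obtain ⟨x, y, x', y', h1, h2, h3, -⟩ := key r hr
      obtain ⟨a, b, a', b', h5, h6, h7, -⟩ := key r' hr'
      simp only [hf, h1, h2, h5, h6, hval] at h
      have e0 := congrFun h 0
      have e1 := congrFun h 1
      have e2 := congrFun h 2
      have e3 := congrFun h 3
      simp only [Matrix.cons_val] at e0 e1 e2 e3
      obtain rfl : x = a := by omega
      obtain rfl : x' = a' := by omega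
      obtain rfl : y = b := by omega
      obtain rfl : y' = b' := by omega
      obtain ⟨s, z, w⟩ := r
      obtain ⟨s', z', w'⟩ := r'
      simp only at h1 h2 h3 h5 h6 h7
      have : s = s' := by rw [h3] at h7; exact_mod_cast h7
      rw [this, h1, h2, h5, h6]

/-- A lower bound for the number of representations of `n` as a sum of `m + 4 ≥ 5` squares: the
first `m` variables run through a box, the first of them in the parity class that leaves an odd
number to be represented by the last four. -/
theorem le_latticeCount {m : ℕ} [NeZero m] {n K : ℕ} (hK : 2 * (m * (2 * K + 1) ^ 2) ≤ n) {lam : ℝ}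
    (hlam : lam ^ 2 = n) : 2 * n * (K + 1) ^ m ≤ latticeCount (m + 4) lam := by
  classical
  -- adding the parity `ε` to the first coordinate makes `n - ∑ x_i²` odd
  set ε : ℕ := (n + 1) % 2 with hε
  set x : (Fin m → Fin (K + 1)) → Fin m → ℕ := fun t i => 2 * t i + if i = 0 then ε else 0 with hx
  have hxle : ∀ t, 2 * ∑ i, x t i ^ 2 ≤ n := by
    intro t
    refine le_trans ?_ hK
    have : ∑ i, x t i ^ 2 ≤ ∑ _i : Fin m, (2 * K + 1) ^ 2 := by
      refine Finset.sum_le_sum fun i _ => Nat.pow_le_pow_left ?_ 2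
      have := (t i).is_le
      simp only [hx]
      split_ifs <;> omega
    simpa using this
  have hodd : ∀ t, Odd (n - ∑ i, x t i ^ 2) := by
    intro t
    have h1 : (∑ i, x t i ^ 2) % 2 = ε % 2 := by
      have h2 : ∀ i, x t i ^ 2 ≡ (if i = 0 then ε else 0) [MOD 2] := by
        intro i
        have h3 : x t i ≡ (if i = 0 then ε else 0) [MOD 2] := by
          simp [hx, Nat.ModEq, Nat.add_mod]
        refine (h3.pow 2).trans ?_
        split_ifs
        · rcases (show ε = 0 ∨ ε = 1 by omega) with h | h <;> rw [h] <;> rfl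
        · rfl
      have h4 : ∑ i, x t i ^ 2 ≡ ∑ i : Fin m, (if i = 0 then ε else 0) [MOD 2] :=
        Nat.ModEq.sum fun i _ => h2 i
      rw [Finset.sum_ite_eq' Finset.univ (0 : Fin m) (fun _ => ε)] at h4
      simpa [Nat.ModEq] using h4
    have := hxle t
    rw [Nat.odd_iff]
    omega
  have hF := fun t => exists_four_squares_finset (hodd t)
  choose F hF1 hF2 using hF
  set P : Finset (Σ _ : Fin m → Fin (K + 1), Fin 4 → ℤ) := Finset.univ.sigma F with hP
  set f : (Σ _ : Fin m → Fin (K + 1), Fin 4 → ℤ) → Fin (m + 4) → ℤ := fun r =>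
    Fin.append (fun i => (x r.1 i : ℤ)) r.2 with hf
  have hinj : Function.Injective f := by
    rintro ⟨t, q⟩ ⟨t', q'⟩ h
    have h1 : ∀ i, (x t i : ℤ) = x t' i := fun i => by
      simpa [hf] using congrFun h (Fin.castAdd 4 i)
    have h2 : q = q' := by
      ext i
      simpa [hf] using congrFun h (Fin.natAdd m i)
    have h3 : t = t' := by
      ext i
      have := h1 i
      simp only [hx] at this
      split_ifs at this <;> omega
    rw [h2, h3]
  have hsub : (P.image f : Set (Fin (m + 4) → ℤ)) ⊆ latticeSphere (m + 4) lam := by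
    intro k hk
    simp only [Finset.coe_image, Set.mem_image, Finset.mem_coe] at hk
    obtain ⟨⟨t, q⟩, hr, rfl⟩ := hk
    have hq : q ∈ F t := by simpa [hP] using hr
    have h1 := hF1 t q hq
    have h2 : ∑ i, (f ⟨t, q⟩ i) ^ 2 = (n : ℤ) := by
      rw [Fin.sum_univ_add]
      simp only [hf, Fin.append_left, Fin.append_right]
      rw [h1, Nat.cast_sub (by have := hxle t; omega)]
      push_cast
      ring
    simp only [latticeSphere, Set.mem_ofPred_eq]
    rw [hlam]
    exact_mod_cast h2
  calc 2 * n * (K + 1) ^ m = ∑ _t : Fin m → Fin (K + 1), 2 * n := by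
        simp [mul_comm]
    _ ≤ ∑ t, (F t).card := Finset.sum_le_sum fun t _ => by
        have := hxle t
        have := hF2 t
        omega
    _ = (P.image f).card := by
        rw [Finset.card_image_of_injective _ hinj, hP, Finset.card_sigma]
    _ ≤ latticeCount (m + 4) lam := by
        rw [← Set.ncard_coe_finset]
        exact Set.ncard_le_ncard hsub (latticeSphere_finite _ _)

/-! ### Trigonometric polynomials -/

theorem le_maxVanishingOrder {d : ℕ} {lam : ℝ} {u : EuclideanSpace ℝ (Fin d) → ℂ}
    (hu : u ∈ eigenspace d lam) (hne : u ≠ 0) {N : ℕ} (hN : VanishesToOrder u N) :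
    (N : EReal) ≤ maxVanishingOrder d lam :=
  (le_iSup₂ (f := fun (N : ℕ) (_ : VanishesToOrder u N) => (N : EReal)) N hN).trans
    (le_iSup₂_of_le u hu (le_iSup (fun _ : u ≠ 0 => vanishingOrder u) hne))

theorem laplacian_eq_sum_partialDeriv {d : ℕ} {u : EuclideanSpace ℝ (Fin d) → ℂ}
    (hu : ContDiff ℝ 2 u) (x : EuclideanSpace ℝ (Fin d)) :
    Laplacian.laplacian u x = ∑ j, partialDeriv j (partialDeriv j u) x := by
  rw [InnerProductSpace.laplacian_eq_iteratedFDeriv_orthonormalBasis u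
    (EuclideanSpace.basisFun (Fin d) ℝ)]
  refine Finset.sum_congr rfl fun j _ => ?_
  rw [iteratedFDeriv_two_apply]
  have h : DifferentiableAt ℝ (fderiv ℝ u) x :=
    (hu.fderiv_right (m := 1) (by norm_num)).differentiable (by norm_num) x
  unfold partialDeriv
  rw [fderiv_clm_apply h (differentiableAt_const _)]
  simp

/-- The linear form `x ↦ k · x`. -/
noncomputable def phase {d : ℕ} (k : Fin d → ℤ) : EuclideanSpace ℝ (Fin d) →L[ℝ] ℝ :=
  ∑ j, (k j : ℝ) • EuclideanSpace.proj j

theorem phase_apply {d : ℕ} (k : Fin d → ℤ) (x : EuclideanSpace ℝ (Fin d)) :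
    phase k x = ∑ j, (k j : ℝ) * x j := by
  simp [phase]

theorem phase_single {d : ℕ} (k : Fin d → ℤ) (j : Fin d) (t : ℝ) :
    phase k (EuclideanSpace.single j t) = k j * t := by
  simp [phase_apply]

/-- The trigonometric polynomial `x ↦ ∑_{k ∈ S} c_k exp(i k · x)`. -/
noncomputable def trigPoly {d : ℕ} (S : Finset (Fin d → ℤ)) (c : (Fin d → ℤ) → ℂ) :
    EuclideanSpace ℝ (Fin d) → ℂ :=
  fun x => ∑ k ∈ S, c k * Complex.exp (Complex.I * (phase k x : ℝ))

section TrigPoly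

variable {d : ℕ} (S : Finset (Fin d → ℤ)) (c : (Fin d → ℤ) → ℂ)

theorem contDiff_trigPoly (n : ℕ∞) : ContDiff ℝ n (trigPoly S c) := by
  unfold trigPoly
  refine ContDiff.sum fun k _ => contDiff_const.mul ?_
  refine (contDiff_const.mul ?_).cexp
  exact Complex.ofRealCLM.contDiff.comp (phase k).contDiff

theorem trigPoly_mem_smoothTorus : trigPoly S c ∈ SmoothTorus d := by
  refine ⟨contDiff_trigPoly S c ⊤, fun j x => ?_⟩
  refine Finset.sum_congr rfl fun k _ => ?_
  rw [map_add, phase_single]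
  have : Complex.I * ((phase k x + k j * (2 * Real.pi) : ℝ) : ℂ) =
      Complex.I * (phase k x : ℝ) + (k j : ℂ) * (2 * Real.pi * Complex.I) := by
    push_cast; ring
  rw [this, Complex.exp_add, Complex.exp_int_mul_two_pi_mul_I, mul_one]

theorem partialDeriv_trigPoly (j : Fin d) :
    partialDeriv j (trigPoly S c) = trigPoly S (fun k => Complex.I * k j * c k) := by
  ext x
  have h : ∀ k ∈ S, HasFDerivAt
      (fun x : EuclideanSpace ℝ (Fin d) => c k * Complex.exp (Complex.I * (phase k x : ℝ)))
      (c k • (Complex.exp (Complex.I * (phase k x : ℝ)) •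
        (Complex.I • (Complex.ofRealCLM.comp (phase k))))) x := by
    intro k _
    have h1 : HasFDerivAt (fun x : EuclideanSpace ℝ (Fin d) => ((phase k x : ℝ) : ℂ))
        (Complex.ofRealCLM.comp (phase k)) x := (Complex.ofRealCLM.comp (phase k)).hasFDerivAt
    exact ((h1.const_mul Complex.I).cexp).const_mul (c k)
  have h2 := HasFDerivAt.fun_sum h
  unfold partialDeriv
  unfold trigPoly
  rw [h2.fderiv]
  simp only [FunLike.coe_sum, Finset.sum_apply, _root_.smul_apply,
    ContinuousLinearMap.comp_apply, phase_single, smul_eq_mul]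
  refine Finset.sum_congr rfl fun k _ => ?_
  simp
  ring

theorem iterate_partialDeriv_trigPoly (j : Fin d) (m : ℕ) :
    (partialDeriv j)^[m] (trigPoly S c) = trigPoly S (fun k => (Complex.I * k j) ^ m * c k) := by
  induction m with
  | zero => simp
  | succ m ih =>
    rw [Function.iterate_succ_apply', ih, partialDeriv_trigPoly]
    congr 1
    ext k
    ring

theorem multiDeriv_trigPoly (α : Fin d → ℕ) :
    multiDeriv α (trigPoly S c) = trigPoly S (fun k => (∏ j, (Complex.I * k j) ^ α j) * c k) := by
  unfold multiDeriv
  have h : ∀ l : List (Fin d), l.foldr (fun j v => (partialDeriv j)^[α j] v) (trigPoly S c) =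
      trigPoly S (fun k => (l.map fun j => (Complex.I * k j) ^ α j).prod * c k) := by
    intro l
    induction l with
    | nil => simp
    | cons j l ih =>
      rw [List.foldr_cons, ih, iterate_partialDeriv_trigPoly]
      congr 1
      ext k
      rw [List.map_cons, List.prod_cons, mul_assoc]
  rw [h]
  simp only [Fin.prod_univ_def]

theorem multiDeriv_trigPoly_zero (α : Fin d → ℕ) :
    multiDeriv α (trigPoly S c) 0 =
      Complex.I ^ (∑ j, α j) * ∑ k ∈ S, c k * ∏ j, (k j : ℂ) ^ α j := by
  rw [multiDeriv_trigPoly]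
  simp only [trigPoly, map_zero, Complex.ofReal_zero, mul_zero, Complex.exp_zero, mul_one]
  rw [Finset.mul_sum]
  refine Finset.sum_congr rfl fun k _ => ?_
  simp only [mul_pow, Finset.prod_mul_distrib, Finset.prod_pow_eq_pow_sum]
  ring

theorem trigPoly_mem_eigenspace {lam : ℝ} (hS : ∀ k ∈ S, k ∈ latticeSphere d lam) :
    trigPoly S c ∈ eigenspace d lam := by
  refine ⟨trigPoly_mem_smoothTorus S c, fun x => ?_⟩
  rw [laplacian_eq_sum_partialDeriv (contDiff_trigPoly S c 2)]
  simp only [partialDeriv_trigPoly]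
  simp only [trigPoly]
  rw [Finset.sum_comm, Finset.mul_sum, ← Finset.sum_neg_distrib]
  refine Finset.sum_congr rfl fun k hk => ?_
  have h : ∑ j, (k j : ℝ) ^ 2 = lam ^ 2 := hS k hk
  rw [← h]
  push_cast
  rw [Finset.sum_mul, ← Finset.sum_neg_distrib]
  refine Finset.sum_congr rfl fun j _ => ?_
  linear_combination (-(k j : ℂ) ^ 2 * c k * Complex.exp (Complex.I * (phase k x : ℝ))) *
    Complex.I_sq

/-- The character `x ↦ exp(i k · x)` of the additive group `ℝ^d`. -/
noncomputable def expChar (k : Fin d → ℤ) : Multiplicative (EuclideanSpace ℝ (Fin d)) →* ℂ where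
  toFun x := Complex.exp (Complex.I * (phase k x.toAdd : ℝ))
  map_one' := by simp
  map_mul' x y := by
    rw [← Complex.exp_add, toAdd_mul, map_add]
    push_cast
    rw [mul_add]

theorem expChar_injective : Function.Injective (expChar (d := d)) := by
  intro k l h
  have h1 : trigPoly {k} (fun _ => 1) = trigPoly {l} (fun _ => 1) := by
    ext x
    simpa [trigPoly, expChar] using DFunLike.congr_fun h (Multiplicative.ofAdd x)
  ext j
  have h2 := congrArg (fun u => partialDeriv j u 0) h1
  simpa [partialDeriv_trigPoly, trigPoly] using h2

/-- Distinct characters are linearly independent. -/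
theorem trigPoly_ne_zero {k : Fin d → ℤ} (hk : k ∈ S) (hc : c k ≠ 0) : trigPoly S c ≠ 0 := by
  intro h
  have hli := (linearIndependent_monoidHom (Multiplicative (EuclideanSpace ℝ (Fin d))) ℂ).comp
    (expChar (d := d)) expChar_injective
  rw [linearIndependent_iff'] at hli
  refine hc (hli S c ?_ k hk)
  ext x
  simpa [trigPoly, expChar] using congrFun h x.toAdd

theorem vanishesToOrder_trigPoly {N : ℕ}
    (h : ∀ α : Fin d → ℕ, ∑ j, α j ≤ N → ∑ k ∈ S, c k * ∏ j, (k j : ℂ) ^ α j = 0) :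
    VanishesToOrder (trigPoly S c) N := fun α hα => by
  rw [multiDeriv_trigPoly_zero, h α hα, mul_zero]

end TrigPoly

/-! ### The dimension count and small orders of vanishing -/

theorem prod_pow_add_single {d : ℕ} (k : Fin d → ℂ) (α : Fin d → ℕ) (i : Fin d) (m : ℕ) :
    ∏ j, k j ^ (α + Pi.single i m : Fin d → ℕ) j = k i ^ m * ∏ j, k j ^ α j := by
  simp only [Pi.add_apply, pow_add, Finset.prod_mul_distrib, Pi.single_apply, pow_ite, pow_zero,
    Finset.prod_ite_eq', Finset.mem_univ, if_true]
  ring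

/-- On a sphere, `k₀² = lam² - ∑_{j ≠ 0} k_j²`, so moments of a measure on the sphere up to degree
`N` vanish as soon as those of degree at most one in `k₀` do. -/
theorem moment_eq_zero {D : ℕ} {lam : ℝ} {S : Finset (Fin (D + 1) → ℤ)}
    (hS : ∀ k ∈ S, k ∈ latticeSphere (D + 1) lam) {c : (Fin (D + 1) → ℤ) → ℂ} {N : ℕ}
    (h : ∀ α : Fin (D + 1) → ℕ, α 0 ≤ 1 → ∑ j, α j ≤ N → ∑ k ∈ S, c k * ∏ j, (k j : ℂ) ^ α j = 0)
    (α : Fin (D + 1) → ℕ) (hα : ∑ j, α j ≤ N) : ∑ k ∈ S, c k * ∏ j, (k j : ℂ) ^ α j = 0 := by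
  induction ha : α 0 using Nat.strong_induction_on generalizing α with
  | _ a ih =>
  rcases Nat.lt_or_ge a 2 with ha2 | ha2
  · exact h α (by omega) hα
  set β : Fin (D + 1) → ℕ := Function.update α 0 (a - 2) with hβ
  have hβα : α = β + Pi.single 0 2 := by
    ext j
    by_cases hj : j = 0
    · subst hj; simp [hβ]; omega
    · simp [hβ, hj]
  have hβ0 : β 0 = a - 2 := by simp [hβ]
  have hsum : ∀ (i : Fin (D + 1)), ∑ j, (β + Pi.single i 2 : Fin (D + 1) → ℕ) j = ∑ j, β j + 2 := by
    intro i
    simp [Finset.sum_add_distrib]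
  have hβs : ∑ j, β j + 2 ≤ N := by
    rw [← hsum 0, ← hβα]; exact hα
  have h1 := ih (a - 2) (by omega) β (by omega) hβ0
  have h2 : ∀ i : Fin D, ∑ k ∈ S, c k * ∏ j, (k j : ℂ) ^ (β + Pi.single i.succ 2 : Fin (D + 1) → ℕ) j
      = 0 := fun i => ih (a - 2) (by omega) _ (by rw [hsum]; exact hβs) (by simp [hβ0])
  have h3 : ∑ k ∈ S, c k * ∏ j, (k j : ℂ) ^ α j =
      (lam : ℂ) ^ 2 * (∑ k ∈ S, c k * ∏ j, (k j : ℂ) ^ β j) -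
      ∑ i : Fin D, ∑ k ∈ S,
        c k * ∏ j, (k j : ℂ) ^ (β + Pi.single i.succ 2 : Fin (D + 1) → ℕ) j := by
    rw [Finset.sum_comm, Finset.mul_sum, ← Finset.sum_sub_distrib]
    refine Finset.sum_congr rfl fun k hk => ?_
    have hk' : (k 0 : ℂ) ^ 2 + ∑ i : Fin D, (k i.succ : ℂ) ^ 2 = (lam : ℂ) ^ 2 := by
      have : ∑ j, (k j : ℝ) ^ 2 = lam ^ 2 := hS k hk
      rw [Fin.sum_univ_succ] at this
      exact_mod_cast congrArg (Complex.ofReal) this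
    rw [hβα]
    simp only [prod_pow_add_single (fun j => (k j : ℂ))]
    rw [← hk', ← Finset.mul_sum, ← Finset.sum_mul]
    ring
  rw [h3, h1, Finset.sum_eq_zero fun i _ => h2 i]
  simp

/-- The exponents of degree at most `N` that are at most linear in the variable `0`. -/
theorem exists_reduced_exponents (D N : ℕ) : ∃ I : Finset (Fin (D + 1) → ℕ),
    (∀ α : Fin (D + 1) → ℕ, α 0 ≤ 1 → ∑ j, α j ≤ N → α ∈ I) ∧
    I.card ≤ (N + D).choose D + (N + D - 1).choose D := by
  classical
  -- the entry at `0` of an element of the antidiagonal is the slack `N - ∑ j, α j`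
  set A : ℕ → Finset (Fin (D + 1) →₀ ℕ) := fun e =>
    if e ≤ N then Finset.univ.finsuppAntidiag (N - e) else ∅ with hA
  have hAc : ∀ e, (A e).card ≤ (N + D - e).choose D := by
    intro e
    simp only [hA]
    split_ifs with he
    · rw [Finset.card_finsuppAntidiag_nat_eq_choose, Finset.card_univ, Fintype.card_fin,
        show D + 1 + (N - e) - 1 = D + (N - e) by omega, show N + D - e = D + (N - e) by omega,
        Nat.choose_symm_add]
    · simp
  set f : ℕ → (Fin (D + 1) →₀ ℕ) → (Fin (D + 1) → ℕ) := fun e β => Function.update β 0 e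
  refine ⟨(A 0).image (f 0) ∪ (A 1).image (f 1), ?_, ?_⟩
  · intro α h0 hα
    have hmem : α ∈ (A (α 0)).image (f (α 0)) := by
      rw [Finset.mem_image]
      refine ⟨Finsupp.equivFunOnFinite.symm (Function.update α 0 (N - ∑ j, α j)), ?_, ?_⟩
      · rw [Fin.sum_univ_succ] at hα
        simp only [hA, if_pos (show α 0 ≤ N by omega)]
        rw [Finset.mem_finsuppAntidiag]
        refine ⟨?_, Finset.subset_univ _⟩
        simp only [Finsupp.equivFunOnFinite_symm_apply_apply]
        rw [Fin.sum_univ_succ, Fin.sum_univ_succ]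
        simp only [Function.update_self, ne_eq, Fin.succ_ne_zero, not_false_eq_true,
          Function.update_of_ne]
        omega
      · ext j
        by_cases hj : j = 0
        · subst hj; simp [f]
        · simp [f, hj]
    rw [Finset.mem_union]
    rcases (show α 0 = 0 ∨ α 0 = 1 by omega) with h | h <;> rw [h] at hmem
    · exact Or.inl hmem
    · exact Or.inr hmem
  · refine (Finset.card_union_le _ _).trans (add_le_add ?_ ?_)
    · exact Finset.card_image_le.trans (hAc 0)
    · exact Finset.card_image_le.trans (hAc 1)

/-- The dimension count: the conditions for vanishing to order `N` on a trigonometric polynomial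
with frequencies on the sphere amount to at most `(N + D).choose D + (N + D - 1).choose D` linear
equations. -/
theorem natCast_le_maxVanishingOrder {D N : ℕ} {lam : ℝ}
    (h : (N + D).choose D + (N + D - 1).choose D < latticeCount (D + 1) lam) :
    (N : EReal) ≤ maxVanishingOrder (D + 1) lam := by
  classical
  obtain ⟨I, hI, hIc⟩ := exists_reduced_exponents D N
  set S := (latticeSphere_finite (D + 1) lam).toFinset with hSdef
  have hS : ∀ k ∈ S, k ∈ latticeSphere (D + 1) lam := fun k hk => by simpa [hSdef] using hk
  have hSc : S.card = latticeCount (D + 1) lam := by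
    rw [latticeCount, Set.ncard_eq_toFinset_card _ (latticeSphere_finite (D + 1) lam)]
  let T : (S → ℂ) →ₗ[ℂ] (I → ℂ) :=
    { toFun := fun c α => ∑ k, c k * ∏ j, (k.1 j : ℂ) ^ α.1 j
      map_add' := fun c c' => by
        ext α; simp [add_mul, Finset.sum_add_distrib]
      map_smul' := fun r c => by
        ext α; simp [Finset.mul_sum, mul_assoc] }
  have hker : T.ker ≠ ⊥ := by
    apply LinearMap.ker_ne_bot_of_finrank_lt
    simp only [Module.finrank_fintype_fun_eq_card, Fintype.card_coe]
    omega
  obtain ⟨c, hc, hc0⟩ := Submodule.exists_mem_ne_zero_of_ne_bot hker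
  obtain ⟨k₀, hk₀⟩ := Function.ne_iff.1 hc0
  set c' : (Fin (D + 1) → ℤ) → ℂ := fun k => if hk : k ∈ S then c ⟨k, hk⟩ else 0 with hc'
  refine le_maxVanishingOrder (trigPoly_mem_eigenspace S c' hS)
    (trigPoly_ne_zero S c' k₀.2 (by simpa [hc'] using hk₀)) (vanishesToOrder_trigPoly S c' ?_)
  refine moment_eq_zero hS fun α h0 hα => ?_
  have h1 := congrFun (LinearMap.mem_ker.1 hc) ⟨α, hI α h0 hα⟩
  rw [← Finset.sum_coe_sort S]
  simpa [T, hc'] using h1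

/-- Besides `±k`, a sphere of positive radius through a lattice point `k` contains some other
lattice point. -/
theorem exists_latticeSphere_ne {d : ℕ} (hd : 2 ≤ d) {lam : ℝ} (hlam : 0 < lam) {k : Fin d → ℤ}
    (hk : k ∈ latticeSphere d lam) : ∃ l ∈ latticeSphere d lam, l ≠ k ∧ l ≠ -k := by
  have hk' : ∑ j, (k j : ℝ) ^ 2 = lam ^ 2 := hk
  obtain ⟨j, hj⟩ : ∃ j, k j ≠ 0 := by
    by_contra! h
    simp [h] at hk'
    exact (pow_pos hlam 2).ne hk'
  have : Nontrivial (Fin d) := Fin.nontrivial_iff_two_le.2 hd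
  obtain ⟨i, hij⟩ := exists_ne j
  by_cases hi : k i = 0
  · refine ⟨k ∘ Equiv.swap i j, ?_, ?_, ?_⟩
    · change ∑ l, (k (Equiv.swap i j l) : ℝ) ^ 2 = lam ^ 2
      rw [← hk']
      exact Equiv.sum_comp (Equiv.swap i j) (fun l => (k l : ℝ) ^ 2)
    · intro h
      have := congrFun h j
      simp [hi] at this
      omega
    · intro h
      have := congrFun h j
      simp [hi] at this
      omega
  · refine ⟨Function.update k j (-k j), ?_, ?_, ?_⟩
    · change ∑ l, ((Function.update k j (-k j) l : ℤ) : ℝ) ^ 2 = lam ^ 2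
      rw [← hk']
      refine Finset.sum_congr rfl fun l _ => ?_
      by_cases hl : l = j
      · subst hl; simp
      · simp [hl]
    · intro h
      have := congrFun h j
      simp at this
      omega
    · intro h
      have := congrFun h i
      simp [hij] at this
      omega

theorem neg_mem_latticeSphere {d : ℕ} {lam : ℝ} {k : Fin d → ℤ} (hk : k ∈ latticeSphere d lam) :
    -k ∈ latticeSphere d lam := by
  have hk' : ∑ j, (k j : ℝ) ^ 2 = lam ^ 2 := hk
  simpa [latticeSphere] using hk'

/-- For two lattice points `k` and `l ≠ ±k` of the sphere, the eigenfunction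
`cos(k · x) - cos(l · x)` vanishes at the origin together with its gradient. -/
theorem one_le_maxVanishingOrder {d : ℕ} (hd : 2 ≤ d) {lam : ℝ} (hlam : 0 < lam)
    (h : (latticeSphere d lam).Nonempty) : (1 : EReal) ≤ maxVanishingOrder d lam := by
  classical
  obtain ⟨k, hk⟩ := h
  obtain ⟨l, hl, hlk, hlk'⟩ := exists_latticeSphere_ne hd hlam hk
  have hself : ∀ m ∈ latticeSphere d lam, m ≠ -m := by
    intro m hm h0
    have hm' : ∑ j, (m j : ℝ) ^ 2 = lam ^ 2 := hm
    have : m = 0 := self_eq_neg.1 h0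
    rw [this] at hm'
    simp at hm'
    exact (pow_pos hlam 2).ne hm'
  set S : Finset (Fin d → ℤ) := {k, -k, l, -l} with hS
  set c : (Fin d → ℤ) → ℂ := fun m => if m = k ∨ m = -k then 1 else -1 with hc
  have hsum : ∀ g : (Fin d → ℤ) → ℂ, ∑ m ∈ S, c m * g m = g k + g (-k) - g l - g (-l) := by
    intro g
    have hlk2 : -l ≠ k := fun h => hlk' (by rw [← h, neg_neg])
    have hlk3 : -l ≠ -k := fun h => hlk (neg_injective h)
    rw [hS, Finset.sum_insert, Finset.sum_insert, Finset.sum_insert, Finset.sum_singleton]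
    · have e1 : c k = 1 := by simp [hc]
      have e2 : c (-k) = 1 := by simp [hc]
      have e3 : c l = -1 := by simp [hc, hlk, hlk']
      have e4 : c (-l) = -1 := by simp only [hc, hlk2, hlk3, or_self, if_false]
      rw [e1, e2, e3, e4]
      ring
    · simpa using hself l hl
    · simp only [Finset.mem_insert, Finset.mem_singleton, not_or]
      exact ⟨hlk'.symm, hlk3.symm⟩
    · simp only [Finset.mem_insert, Finset.mem_singleton, not_or]
      exact ⟨hself k hk, hlk.symm, hlk2.symm⟩
  have hmem : ∀ m ∈ S, m ∈ latticeSphere d lam := by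
    intro m hm
    simp only [hS, Finset.mem_insert, Finset.mem_singleton] at hm
    rcases hm with rfl | rfl | rfl | rfl
    exacts [hk, neg_mem_latticeSphere hk, hl, neg_mem_latticeSphere hl]
  have hv : VanishesToOrder (trigPoly S c) 1 := by
    refine vanishesToOrder_trigPoly S c fun α hα => ?_
    rw [hsum fun m => ∏ j, (m j : ℂ) ^ α j]
    have hneg : ∀ m : Fin d → ℤ, ∏ j, ((-m) j : ℂ) ^ α j =
        (-1) ^ (∑ j, α j) * ∏ j, (m j : ℂ) ^ α j := by
      intro m
      rw [← Finset.prod_pow_eq_pow_sum, ← Finset.prod_mul_distrib]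
      refine Finset.prod_congr rfl fun j _ => ?_
      rw [← mul_pow]
      simp
    rw [hneg, hneg]
    rcases (show ∑ j, α j = 0 ∨ ∑ j, α j = 1 by omega) with h0 | h1
    · have : ∀ j, α j = 0 := by simpa using h0
      simp [this]
    · rw [h1]; ring
  have := le_maxVanishingOrder (trigPoly_mem_eigenspace S c hmem)
    (trigPoly_ne_zero S c (k := k) (by simp [hS]) (by simp [hc])) hv
  simpa using this

theorem partialDeriv_comp_add_left {d : ℕ} (j : Fin d) (u : EuclideanSpace ℝ (Fin d) → ℂ)
    (y : EuclideanSpace ℝ (Fin d)) :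
    partialDeriv j (fun x => u (y + x)) = fun x => partialDeriv j u (y + x) := by
  ext x
  simp [partialDeriv, fderiv_comp_add_left]

theorem partialDeriv_comp_sub_left {d : ℕ} (j : Fin d) {u : EuclideanSpace ℝ (Fin d) → ℂ}
    (hu : Differentiable ℝ u) (y : EuclideanSpace ℝ (Fin d)) :
    partialDeriv j (fun x => u (y - x)) = fun x => -partialDeriv j u (y - x) := by
  ext x
  have h : HasFDerivAt (fun x => u (y - x)) _ x :=
    (hu (y - x)).hasFDerivAt.comp x ((hasFDerivAt_id x).const_sub y)
  simp only [partialDeriv]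
  rw [h.fderiv]
  simp

theorem contDiff_partialDeriv {d : ℕ} (j : Fin d) {u : EuclideanSpace ℝ (Fin d) → ℂ}
    (hu : ContDiff ℝ (⊤ : ℕ∞) u) : ContDiff ℝ (⊤ : ℕ∞) (partialDeriv j u) :=
  (hu.fderiv_right (by simp)).clm_apply contDiff_const

/-- If `u` is an eigenfunction then so is its odd part about any point. -/
theorem oddPart_mem_eigenspace {d : ℕ} {lam : ℝ} {u : EuclideanSpace ℝ (Fin d) → ℂ}
    (hu : u ∈ eigenspace d lam) (y : EuclideanSpace ℝ (Fin d)) :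
    (fun x => u (y + x) - u (y - x)) ∈ eigenspace d lam := by
  obtain ⟨⟨hsm, hper⟩, heig⟩ := hu
  have h2 : ∀ {v : EuclideanSpace ℝ (Fin d) → ℂ}, ContDiff ℝ (⊤ : ℕ∞) v → ContDiff ℝ 2 v :=
    fun h => (contDiff_infty.1 h) 2
  have h0 : ∀ {v : EuclideanSpace ℝ (Fin d) → ℂ}, ContDiff ℝ (⊤ : ℕ∞) v → Differentiable ℝ v :=
    fun h => h.differentiable (by simp)
  have hs1 : ContDiff ℝ (⊤ : ℕ∞) (fun x => u (y + x)) := hsm.comp (contDiff_const.add contDiff_id)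
  have hs2 : ContDiff ℝ (⊤ : ℕ∞) (fun x => u (y - x)) := hsm.comp (contDiff_const.sub contDiff_id)
  refine ⟨⟨hs1.sub hs2, fun j x => ?_⟩, fun x => ?_⟩
  · simp only
    rw [← add_assoc, hper]
    congr 1
    rw [← hper j (y - (x + _))]
    congr 1
    abel
  · have hl1 : Laplacian.laplacian (fun x => u (y + x)) x = Laplacian.laplacian u (y + x) := by
      rw [laplacian_eq_sum_partialDeriv (h2 hs1), laplacian_eq_sum_partialDeriv (h2 hsm)]
      refine Finset.sum_congr rfl fun j _ => ?_
      rw [partialDeriv_comp_add_left, partialDeriv_comp_add_left]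
    have hl2 : Laplacian.laplacian (fun x => u (y - x)) x = Laplacian.laplacian u (y - x) := by
      rw [laplacian_eq_sum_partialDeriv (h2 hs2), laplacian_eq_sum_partialDeriv (h2 hsm)]
      refine Finset.sum_congr rfl fun j _ => ?_
      rw [partialDeriv_comp_sub_left j (h0 hsm)]
      have h3 := partialDeriv_comp_sub_left j (h0 (contDiff_partialDeriv j hsm)).neg y
      have h4 := congrFun h3 x
      simp only [Pi.neg_apply] at h4
      rw [h4]
      simp [partialDeriv, fderiv_neg]
    have hl : Laplacian.laplacian ((fun x => u (y + x)) - fun x => u (y - x)) x =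
        Laplacian.laplacian u (y + x) - Laplacian.laplacian u (y - x) := by
      rw [(h2 hs1).contDiffAt.laplacian_sub (h2 hs2).contDiffAt, hl1, hl2]
    change -(Laplacian.laplacian ((fun x => u (y + x)) - fun x => u (y - x)) x) = _
    rw [hl, mul_sub, ← heig, ← heig]
    ring

/-- A nonzero eigenfunction for a positive eigenvalue is not constant, so one of its odd parts
about a point is nonzero. Odd parts vanish at the origin. -/
theorem zero_le_maxVanishingOrder {d : ℕ} {lam : ℝ} (hlam : 0 < lam)
    (h : ∃ u ∈ eigenspace d lam, u ≠ 0) : (0 : EReal) ≤ maxVanishingOrder d lam := by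
  obtain ⟨u, hu, hu0⟩ := h
  obtain ⟨y, hy⟩ : ∃ y : EuclideanSpace ℝ (Fin d), (fun x => u (y + x) - u (y - x)) ≠ 0 := by
    by_contra! hall
    have hconst : u = fun _ => u 0 := by
      ext x
      have := congrFun (hall ((1 / 2 : ℝ) • x)) ((1 / 2 : ℝ) • x)
      simp only [Pi.zero_apply, sub_self, ← add_smul] at this
      norm_num at this
      exact sub_eq_zero.1 this
    have h1 := hu.2 0
    have h2 : Laplacian.laplacian u (0 : EuclideanSpace ℝ (Fin d)) = 0 := by
      rw [hconst, InnerProductSpace.laplacian_const]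
      rfl
    rw [h2, neg_zero, eq_comm, mul_eq_zero] at h1
    rcases h1 with h1 | h1
    · exact (pow_pos hlam 2).ne' (by exact_mod_cast h1)
    · exact hu0 (by rw [hconst, h1]; rfl)
  have hv : VanishesToOrder (fun x => u (y + x) - u (y - x)) 0 := by
    intro α hα
    have : ∀ j, α j = 0 := by simpa using hα
    have hid : ∀ (l : List (Fin d)) (w : EuclideanSpace ℝ (Fin d) → ℂ),
        l.foldr (fun j v => (partialDeriv j)^[α j] v) w = w := by
      intro l w
      induction l with
      | nil => rfl
      | cons j l ih => rw [List.foldr_cons, ih, this j]; rfl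
    rw [multiDeriv, hid]
    simp
  simpa using le_maxVanishingOrder (oddPart_mem_eigenspace hu y) hy hv

/-! ### Estimates for the binomials and the lattice point count -/

/-- From `(N + D).choose D ≤ (N + D) ^ D / D!` and `D ^ D / D! ≤ e ^ D ≤ 3 ^ D`. -/
theorem choose_add_choose_le {D N : ℕ} (hD : 1 ≤ D) :
    (((N + D).choose D + (N + D - 1).choose D : ℕ) : ℝ) ≤ (6 * ((N + D : ℝ) / D)) ^ D := by
  have hD0 : (0 : ℝ) < D := by exact_mod_cast hD
  have h1 : (N + D - 1).choose D ≤ (N + D).choose D := Nat.choose_le_choose D (by omega)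
  have h2 : ((N + D).choose D : ℝ) ≤ ((N + D : ℕ) : ℝ) ^ D / (D.factorial : ℝ) :=
    Nat.choose_le_pow_div D (N + D)
  have h3 : (D : ℝ) ^ D / (D.factorial : ℝ) ≤ 3 ^ D := by
    refine (Real.pow_div_factorial_le_exp (D : ℝ) hD0.le D).trans ?_
    rw [← Real.exp_one_pow]
    exact pow_le_pow_left₀ (Real.exp_pos 1).le Real.exp_one_lt_three.le D
  have h4 : ((N + D : ℕ) : ℝ) ^ D / (D.factorial : ℝ) =
      ((N + D : ℝ) / D) ^ D * ((D : ℝ) ^ D / (D.factorial : ℝ)) := by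
    push_cast
    rw [div_pow]
    field_simp
  have h5 : (2 : ℝ) ≤ 2 ^ D := by
    simpa using pow_le_pow_right₀ (by norm_num : (1 : ℝ) ≤ 2) hD
  calc (((N + D).choose D + (N + D - 1).choose D : ℕ) : ℝ)
      ≤ 2 * ((N + D).choose D : ℝ) := by
        have : ((N + D - 1).choose D : ℝ) ≤ (N + D).choose D := by exact_mod_cast h1
        push_cast
        linarith
    _ ≤ 2 ^ D * (((N + D : ℝ) / D) ^ D * 3 ^ D) := by
        rw [h4] at h2
        refine mul_le_mul h5 (h2.trans ?_) (by positivity) (by positivity)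
        exact mul_le_mul_of_nonneg_left h3 (by positivity)
    _ = (6 * ((N + D : ℝ) / D)) ^ D := by
        rw [mul_pow, show (6 : ℝ) = 2 * 3 by norm_num, mul_pow]
        ring

/-- With `ρ` the `D`-th root of the lattice point count and `N = ⌈D ρ / 12⌉`, the number of equations
is at most `(ρ / 2 + 12) ^ D`, which is less than `ρ ^ D` for `ρ > 24`. -/
theorem le_maxVanishingOrder_of_large {D : ℕ} (hD : 1 ≤ D) {lam : ℝ}
    (h : 24 < (latticeCount (D + 1) lam : ℝ) ^ (1 / (D : ℝ))) :
    ((1 / 12 * D * (latticeCount (D + 1) lam : ℝ) ^ (1 / (D : ℝ)) : ℝ) : EReal) ≤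
      maxVanishingOrder (D + 1) lam := by
  have hD1 : (1 : ℝ) ≤ D := by exact_mod_cast hD
  have hpow : ((latticeCount (D + 1) lam : ℝ) ^ (1 / (D : ℝ))) ^ D = latticeCount (D + 1) lam := by
    rw [one_div]
    exact Real.rpow_inv_natCast_pow (by positivity) (by omega)
  set ρ := (latticeCount (D + 1) lam : ℝ) ^ (1 / (D : ℝ)) with hρ
  set N := ⌈1 / 12 * D * ρ⌉₊ with hN
  have hN1 : (N : ℝ) < 1 / 12 * D * ρ + 1 := Nat.ceil_lt_add_one (by positivity)
  refine le_trans ?_ (natCast_le_maxVanishingOrder (N := N) ?_)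
  · have : 1 / 12 * D * ρ ≤ (N : ℝ) := Nat.le_ceil _
    exact_mod_cast this
  · have h1 : (N + D : ℝ) / D ≤ ρ / 12 + 2 := by
      rw [div_le_iff₀ (by positivity)]
      nlinarith
    have h2 : (((N + D).choose D + (N + D - 1).choose D : ℕ) : ℝ) < latticeCount (D + 1) lam := by
      refine (choose_add_choose_le hD).trans_lt ?_
      rw [← hpow]
      exact pow_lt_pow_left₀ (by linarith) (by positivity) (by omega)
    exact_mod_cast h2

theorem latticeSphere_nonempty_of_latticeCount {d : ℕ} {lam : ℝ} (h : latticeCount d lam ≠ 0) :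
    (latticeSphere d lam).Nonempty := by
  rw [latticeCount] at h
  exact Set.nonempty_of_ncard_ne_zero h

theorem exists_sq_eq_natCast {d : ℕ} {lam : ℝ} (h : (latticeSphere d lam).Nonempty) :
    ∃ n : ℕ, lam ^ 2 = n := by
  obtain ⟨k, hk⟩ := h
  have hk' : ∑ j, (k j : ℝ) ^ 2 = lam ^ 2 := hk
  refine ⟨∑ j, (k j).natAbs ^ 2, ?_⟩
  rw [← hk']
  push_cast
  refine Finset.sum_congr rfl fun j _ => ?_
  rw [Nat.cast_natAbs, Int.cast_abs, sq_abs]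

theorem latticeSphere_nonempty_of_four_le {m : ℕ} {lam : ℝ} {n : ℕ} (h : lam ^ 2 = n) :
    (latticeSphere (m + 4) lam).Nonempty := by
  obtain ⟨a, b, c, e, hn⟩ := Nat.sum_four_squares n
  refine ⟨Fin.append (fun _ : Fin m => 0) ![(a : ℤ), b, c, e], ?_⟩
  simp only [latticeSphere, Set.mem_ofPred_eq]
  rw [Fin.sum_univ_add]
  simp only [Fin.append_left, Fin.append_right, Fin.sum_univ_four]
  rw [h, ← hn]
  simp

theorem latticeCount_rpow_eq_zero {D : ℕ} (hD : 1 ≤ D) {lam : ℝ}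
    (h : latticeCount (D + 1) lam = 0) :
    (latticeCount (D + 1) lam : ℝ) ^ (1 / (D : ℝ)) = 0 := by
  have : (0 : ℝ) < D := by exact_mod_cast hD
  rw [h, Nat.cast_zero, Real.zero_rpow (by positivity)]

/-- On spheres with few lattice points `maxVanishingOrder ≥ 1` suffices, or `≥ 0` if there are no
lattice points at all. -/
theorem le_maxVanishingOrder_of_small {D : ℕ} (hD : 1 ≤ D) {lam c : ℝ} (hlam : 0 < lam)
    (hE : ∃ u ∈ eigenspace (D + 1) lam, u ≠ 0) (hc0 : 0 ≤ c) (hc : c * D * 24 ≤ 1)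
    (h : (latticeCount (D + 1) lam : ℝ) ^ (1 / (D : ℝ)) ≤ 24) :
    ((c * D * (latticeCount (D + 1) lam : ℝ) ^ (1 / (D : ℝ)) : ℝ) : EReal) ≤
      maxVanishingOrder (D + 1) lam := by
  by_cases h0 : latticeCount (D + 1) lam = 0
  · rw [latticeCount_rpow_eq_zero hD h0, mul_zero]
    exact zero_le_maxVanishingOrder hlam hE
  · refine le_trans ?_ (one_le_maxVanishingOrder (by omega) hlam
      (latticeSphere_nonempty_of_latticeCount h0))
    have : c * D * (latticeCount (D + 1) lam : ℝ) ^ (1 / (D : ℝ)) ≤ 1 :=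
      (mul_le_mul_of_nonneg_left h (by positivity)).trans hc
    exact_mod_cast this

/-- The bound `le_latticeCount` for `K = ⌊lam / √(18 m)⌋`. -/
theorem le_latticeCount_of_sqrt_le {m : ℕ} (hm : 1 ≤ m) {lam : ℝ} {n : ℕ} (hlam : lam ^ 2 = n)
    (h : √(18 * m) ≤ lam) :
    2 * lam ^ 2 * (lam / √(18 * m)) ^ m ≤ (latticeCount (m + 4) lam : ℝ) := by
  have hm' : (1 : ℝ) ≤ m := by exact_mod_cast hm
  have : NeZero m := ⟨by omega⟩
  have hs : 0 < √(18 * m : ℝ) := Real.sqrt_pos.2 (by positivity)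
  set Z := lam / √(18 * m) with hZ
  have hZ1 : 1 ≤ Z := by rwa [hZ, one_le_div hs]
  have hZsq : 18 * m * Z ^ 2 = n := by
    rw [hZ, div_pow, Real.sq_sqrt (by positivity), hlam]
    field_simp
  have hfl : (⌊Z⌋₊ : ℝ) ≤ Z := Nat.floor_le (by linarith)
  have hK : 2 * (m * (2 * ⌊Z⌋₊ + 1) ^ 2) ≤ n := by
    have h1 : ((2 * (m * (2 * ⌊Z⌋₊ + 1) ^ 2) : ℕ) : ℝ) ≤ n := by
      push_cast
      have h2 : (2 * (⌊Z⌋₊ : ℝ) + 1) ^ 2 ≤ (3 * Z) ^ 2 :=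
        pow_le_pow_left₀ (by positivity) (by linarith) 2
      rw [← hZsq]
      nlinarith
    exact_mod_cast h1
  have h3 : ((2 * n * (⌊Z⌋₊ + 1) ^ m : ℕ) : ℝ) ≤ latticeCount (m + 4) lam := by
    exact_mod_cast le_latticeCount hK hlam
  refine le_trans ?_ h3
  push_cast
  rw [hlam]
  have h4 : Z ≤ (⌊Z⌋₊ : ℝ) + 1 := (Nat.lt_floor_add_one Z).le
  exact mul_le_mul_of_nonneg_left (pow_le_pow_left₀ (by linarith) h4 m) (by positivity)

theorem rpow_le_latticeCount_rpow {m : ℕ} (hm : 1 ≤ m) {lam : ℝ} {n : ℕ} (hlam : lam ^ 2 = n)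
    (h : √(18 * m) ≤ lam) :
    lam ^ (((m : ℝ) + 2) / (m + 3)) ≤
      √(18 * (m + 3)) * (latticeCount (m + 4) lam : ℝ) ^ (1 / ((m : ℝ) + 3)) := by
  have hm' : (1 : ℝ) ≤ m := by exact_mod_cast hm
  have hs : 0 < √(18 * m : ℝ) := Real.sqrt_pos.2 (by positivity)
  have hlam0 : 0 < lam := hs.trans_le h
  have h1 := le_latticeCount_of_sqrt_le hm hlam h
  set A := √(18 * (m + 3) : ℝ) with hA
  have hsA : √(18 * m : ℝ) ≤ A := Real.sqrt_le_sqrt (by linarith)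
  have hA1 : 1 ≤ A := Real.one_le_sqrt.2 (by linarith)
  have h2 : lam ^ (m + 2) ≤ A ^ (m + 3) * (latticeCount (m + 4) lam : ℝ) := by
    have h3 : lam ^ (m + 2) = lam ^ 2 * (lam / √(18 * m)) ^ m * √(18 * m) ^ m := by
      rw [div_pow]
      field_simp
      ring
    have h4 : √(18 * m : ℝ) ^ m ≤ A ^ (m + 3) :=
      (pow_le_pow_left₀ hs.le hsA m).trans (pow_le_pow_right₀ hA1 (by omega))
    have h5 : 0 ≤ lam ^ 2 * (lam / √(18 * m)) ^ m := by positivity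
    rw [h3, mul_comm (A ^ (m + 3))]
    exact mul_le_mul (by linarith) h4 (by positivity) (by positivity)
  have h6 := Real.rpow_le_rpow (by positivity) h2
    (by positivity : (0 : ℝ) ≤ 1 / ((m : ℝ) + 3))
  rw [Real.mul_rpow (by positivity) (by positivity), ← Real.rpow_natCast lam,
    ← Real.rpow_natCast A, ← Real.rpow_mul hlam0.le, ← Real.rpow_mul (by positivity)] at h6
  push_cast at h6
  rw [mul_one_div, mul_one_div_cancel (by positivity), Real.rpow_one] at h6
  exact h6

/-- The lattice point count in dimension `m + 4 ≥ 5`, for large radii. -/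
theorem exists_radius_latticeCount_large {m : ℕ} (hm : 1 ≤ m) :
    ∃ lam₀ : ℝ, 0 < lam₀ ∧ ∀ lam : ℝ, lam₀ ≤ lam → (∃ n : ℕ, lam ^ 2 = n) →
      24 < (latticeCount (m + 4) lam : ℝ) ^ (1 / ((m : ℝ) + 3)) ∧
      lam ^ (((m : ℝ) + 2) / (m + 3)) ≤
        5 * (m + 3) * (latticeCount (m + 4) lam : ℝ) ^ (1 / ((m : ℝ) + 3)) := by
  have hm' : (1 : ℝ) ≤ m := by exact_mod_cast hm
  have hA0 : 0 < √(18 * (m + 3) : ℝ) := Real.sqrt_pos.2 (by positivity)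
  have hA : √(18 * (m + 3) : ℝ) ≤ 5 * (m + 3) := by
    rw [Real.sqrt_le_left (by positivity)]
    nlinarith
  have ht := (tendsto_rpow_atTop (y := ((m : ℝ) + 2) / (m + 3)) (by positivity)).eventually_gt_atTop
    (24 * √(18 * (m + 3) : ℝ))
  obtain ⟨B, hB⟩ := Filter.eventually_atTop.1 ht
  refine ⟨max B √(18 * m), lt_max_of_lt_right (Real.sqrt_pos.2 (by positivity)), ?_⟩
  rintro lam hlam ⟨n, hn⟩
  have h1 := rpow_le_latticeCount_rpow hm hn ((le_max_right _ _).trans hlam)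
  have h2 := hB lam ((le_max_left _ _).trans hlam)
  constructor
  · by_contra! h3
    have := mul_le_mul_of_nonneg_left h3 hA0.le
    linarith
  · exact h1.trans (mul_le_mul_of_nonneg_right hA (by positivity))

/-- The case `d ≥ 5`, with the absolute constant `1 / 60`. -/
theorem exists_radius_rpow_le_maxVanishingOrder {m : ℕ} (hm : 1 ≤ m) :
    ∃ lam₀ : ℝ, 0 < lam₀ ∧ ∀ lam : ℝ, lam₀ ≤ lam → (∃ n : ℕ, lam ^ 2 = n) →
      ((1 / 60 * lam ^ (((m : ℝ) + 2) / (m + 3)) : ℝ) : EReal) ≤ maxVanishingOrder (m + 4) lam := by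
  obtain ⟨lam₀, h0, h⟩ := exists_radius_latticeCount_large hm
  refine ⟨lam₀, h0, fun lam hlam hn => ?_⟩
  obtain ⟨h1, h2⟩ := h lam hlam hn
  have h3 := le_maxVanishingOrder_of_large (D := m + 3) (by omega) (lam := lam)
    (by push_cast; exact h1)
  refine le_trans ?_ h3
  push_cast
  rw [show m + 3 + 1 = m + 4 from rfl]
  have : 1 / 60 * lam ^ (((m : ℝ) + 2) / (m + 3)) ≤
      1 / 12 * (m + 3) * (latticeCount (m + 4) lam : ℝ) ^ (1 / ((m : ℝ) + 3)) := by linarith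
  exact_mod_cast this

end TorusEigen

theorem mainTheorem6 :
    -- a combinatorial criterion for `Γ_d(lam) ≥ N`
    (∀ (d : ℕ) (lam : ℝ) (N : ℕ), 2 ≤ d → 0 ≤ lam →
      (N + d - 1).choose (d - 1) + (N + d - 2).choose (d - 1) < TorusEigen.latticeCount d lam →
      (N : EReal) ≤ TorusEigen.maxVanishingOrder d lam) ∧
    -- the bound by the lattice point count: absolute constant, `lam` large depending on `d`
    (∃ c : ℝ, 0 < c ∧ ∀ d : ℕ, 2 ≤ d → ∃ lam₀ : ℝ, 0 < lam₀ ∧ ∀ lam : ℝ, lam₀ ≤ lam →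
      (∃ u ∈ TorusEigen.eigenspace d lam, u ≠ 0) →
      ((c * ((d : ℝ) - 1) *
          (TorusEigen.latticeCount d lam : ℝ) ^ (1 / ((d : ℝ) - 1)) : ℝ) : EReal)
        ≤ TorusEigen.maxVanishingOrder d lam) ∧
    -- the same bound for all `lam > 0`, constant depending on `d`
    (∀ d : ℕ, 2 ≤ d → ∃ c : ℝ, 0 < c ∧ ∀ lam : ℝ, 0 < lam →
      (∃ u ∈ TorusEigen.eigenspace d lam, u ≠ 0) →
      ((c * ((d : ℝ) - 1) *
          (TorusEigen.latticeCount d lam : ℝ) ^ (1 / ((d : ℝ) - 1)) : ℝ) : EReal)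
        ≤ TorusEigen.maxVanishingOrder d lam) ∧
    -- the bound by a power of `lam`: absolute constant, `lam` large depending on `d`
    (∃ c : ℝ, 0 < c ∧ ∀ d : ℕ, 5 ≤ d → ∃ lam₀ : ℝ, 0 < lam₀ ∧ ∀ lam : ℝ, lam₀ ≤ lam →
      (∃ n : ℕ, lam ^ 2 = (n : ℝ)) →
      ((c * lam ^ (((d : ℝ) - 2) / ((d : ℝ) - 1)) : ℝ) : EReal)
        ≤ TorusEigen.maxVanishingOrder d lam) ∧
    -- the same power for all `lam > 0`, constant depending on `d`
    (∀ d : ℕ, 5 ≤ d → ∃ c : ℝ, 0 < c ∧ ∀ lam : ℝ, 0 < lam →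
      (∃ n : ℕ, lam ^ 2 = (n : ℝ)) →
      ((c * ((d : ℝ) - 1) * lam ^ (((d : ℝ) - 2) / ((d : ℝ) - 1)) : ℝ) : EReal)
        ≤ TorusEigen.maxVanishingOrder d lam) := by
  refine ⟨?_, ⟨1 / 72, by norm_num, ?_⟩, ?_, ⟨1 / 60, by norm_num, ?_⟩, ?_⟩
  · intro d lam N hd _ h
    obtain ⟨D, rfl⟩ : ∃ D, d = D + 1 := ⟨d - 1, by omega⟩
    apply TorusEigen.natCast_le_maxVanishingOrder
    rwa [show N + (D + 1) - 1 = N + D by omega, show N + (D + 1) - 2 = N + D - 1 by omega,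
      Nat.add_sub_cancel] at h
  · intro d hd
    obtain ⟨D, rfl⟩ : ∃ D, d = D + 1 := ⟨d - 1, by omega⟩
    have hcast : ((D + 1 : ℕ) : ℝ) - 1 = D := by push_cast; ring
    simp only [hcast]
    have hD : 1 ≤ D := by omega
    have hlarge : ∀ lam : ℝ, 24 < (TorusEigen.latticeCount (D + 1) lam : ℝ) ^ (1 / (D : ℝ)) →
        ((1 / 72 * D * (TorusEigen.latticeCount (D + 1) lam : ℝ) ^ (1 / (D : ℝ)) : ℝ) : EReal) ≤
          TorusEigen.maxVanishingOrder (D + 1) lam := by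
      intro lam h
      refine le_trans ?_ (TorusEigen.le_maxVanishingOrder_of_large hD h)
      rw [EReal.coe_le_coe_iff]
      gcongr
      norm_num
    -- for `D ≤ 3` the count may stay bounded, but then `1 / 72 * D * 24 ≤ 1`;
    -- for `D ≥ 4` it exceeds `24 ^ D` from some radius on
    rcases Nat.lt_or_ge D 4 with hD4 | hD4
    · refine ⟨1, one_pos, fun lam hlam hE => ?_⟩
      rcases le_or_gt ((TorusEigen.latticeCount (D + 1) lam : ℝ) ^ (1 / (D : ℝ))) 24 with h | h
      · have : (D : ℝ) ≤ 3 := by exact_mod_cast Nat.lt_succ_iff.1 hD4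
        exact TorusEigen.le_maxVanishingOrder_of_small hD (by linarith) hE (by norm_num)
          (by linarith) h
      · exact hlarge lam h
    · obtain ⟨m, rfl⟩ : ∃ m, D = m + 3 := ⟨D - 3, by omega⟩
      obtain ⟨lam₀, h0, h⟩ := TorusEigen.exists_radius_latticeCount_large (m := m) (by omega)
      refine ⟨lam₀, h0, fun lam hlam hE => ?_⟩
      by_cases hc : TorusEigen.latticeCount (m + 3 + 1) lam = 0
      · rw [TorusEigen.latticeCount_rpow_eq_zero hD hc, mul_zero]
        exact TorusEigen.zero_le_maxVanishingOrder (by linarith) hE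
      · apply hlarge
        have := (h lam hlam (TorusEigen.exists_sq_eq_natCast
          (TorusEigen.latticeSphere_nonempty_of_latticeCount hc))).1
        push_cast
        exact this
  · intro d hd
    obtain ⟨D, rfl⟩ : ∃ D, d = D + 1 := ⟨d - 1, by omega⟩
    have hcast : ((D + 1 : ℕ) : ℝ) - 1 = D := by push_cast; ring
    simp only [hcast]
    have hD : 1 ≤ D := by omega
    have hD1 : (1 : ℝ) ≤ D := by exact_mod_cast hD
    refine ⟨1 / (24 * D), by positivity, fun lam hlam hE => ?_⟩
    rcases le_or_gt ((TorusEigen.latticeCount (D + 1) lam : ℝ) ^ (1 / (D : ℝ))) 24 with h | h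
    · exact TorusEigen.le_maxVanishingOrder_of_small hD hlam hE (by positivity)
        (le_of_eq (by field_simp)) h
    · refine le_trans ?_ (TorusEigen.le_maxVanishingOrder_of_large hD h)
      rw [EReal.coe_le_coe_iff]
      gcongr
      linarith
  · intro d hd
    obtain ⟨m, rfl⟩ : ∃ m, d = m + 4 := ⟨d - 4, by omega⟩
    have hp : (((m + 4 : ℕ) : ℝ) - 2) / (((m + 4 : ℕ) : ℝ) - 1) = ((m : ℝ) + 2) / (m + 3) := by
      push_cast; congr 1 <;> ring
    simp only [hp]
    exact TorusEigen.exists_radius_rpow_le_maxVanishingOrder (by omega)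
  · intro d hd
    obtain ⟨m, rfl⟩ : ∃ m, d = m + 4 := ⟨d - 4, by omega⟩
    have hp : (((m + 4 : ℕ) : ℝ) - 2) / (((m + 4 : ℕ) : ℝ) - 1) = ((m : ℝ) + 2) / (m + 3) := by
      push_cast; congr 1 <;> ring
    have hcast : ((m + 4 : ℕ) : ℝ) - 1 = m + 3 := by push_cast; ring
    simp only [hp]
    simp only [hcast]
    obtain ⟨lam₀, h0, h⟩ :=
      TorusEigen.exists_radius_rpow_le_maxVanishingOrder (m := m) (by omega)
    set p := ((m : ℝ) + 2) / (m + 3) with hpdef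
    have hp0 : 0 ≤ p := by positivity
    have hpow : 0 < lam₀ ^ p := Real.rpow_pos_of_pos h0 p
    have hm3 : (0 : ℝ) < m + 3 := by positivity
    refine ⟨min (1 / 60) (1 / lam₀ ^ p) / (m + 3), by positivity, fun lam hlam hn => ?_⟩
    rw [div_mul_cancel₀ _ hm3.ne']
    have hlp : 0 ≤ lam ^ p := Real.rpow_nonneg hlam.le p
    rcases le_or_gt lam₀ lam with hl | hl
    · refine le_trans ?_ (h lam hl hn)
      rw [EReal.coe_le_coe_iff]
      exact mul_le_mul_of_nonneg_right (min_le_left _ _) hlp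
    · obtain ⟨n, hn⟩ := hn
      refine le_trans ?_ (TorusEigen.one_le_maxVanishingOrder (by omega) hlam
        (TorusEigen.latticeSphere_nonempty_of_four_le hn))
      have h1 : min (1 / 60) (1 / lam₀ ^ p) * lam ^ p ≤ 1 := by
        calc min (1 / 60) (1 / lam₀ ^ p) * lam ^ p ≤ 1 / lam₀ ^ p * lam₀ ^ p :=
              mul_le_mul (min_le_right _ _) (Real.rpow_le_rpow hlam.le hl.le hp0) hlp
                (by positivity)
          _ = 1 := by field_simp
      exact_mod_cast h1
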